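/- Let $k$ be a field. A variety over $k$ is an integral separated scheme of finite type over $k$, and all rational maps are over $k$. The exceptional locus of a birational map $g\colon X\dashrightarrow Y$ of varieties is the closed set of points of $X$ that have no open neighbourhood on which $g$ is defined and induces an isomorphism onto an open subset of $Y$; $\operatorname{Exc}^{m}(g)$ denotes the (finite) set of its irreducible components of codimension $m$ in $X$. The map $g$ is an isomorphism in codimension $\ell$ if the exceptional loci of $g$ and $g^{-1}$ have codimension $>\ell$ (the empty set has codimension $\infty$), and $\operatorname{Psaut}^{\ell}(X)$ is the group of birational transformations of $X$ that are isomorphisms in codimension $\ell$. For $f\in\operatorname{Psaut}^{\ell}(X)$ put $$\nu^{\ell+1}(f)=\lim_{n\to\infty}\frac{|\operatorname{Exc}^{\ell+1}(f^n)|}{n}.$$ **Proposition.** Let $X$ be a variety over a field $k$, let $\ell\ge 0$ be an integer and let $f\in \operatorname{Psaut}^\ell(X)$. Then: 1. the limit $\nu^{\ell+1}(f)$ exists and is an integer; 2. the sequence $\big(|\operatorname{Exc}^{\ell+1}(f^n)|\big)_{n\ge 0}$ is either bounded or grows asymptotically linearly in $n$, i.e. $|\operatorname{Exc}^{\ell+1}(f^n)|\sim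 cn$ as $n\to\infty$ for some real $c>0$; 3. there exist a variety $Y$ over $k$ and an isomorphism in codimension $\ell$, $\varphi\colon Y\dashrightarrow X$, such that $|\operatorname{Exc}^{\ell+1}(\varphi^{-1}f\varphi)|=\nu^{\ell+1}(f)$ and $|\operatorname{Exc}^{\ell+1}(\varphi^{-1}f^{-1}\varphi)|=\nu^{\ell+1}(f^{-1})$; 4. $\nu^{\ell+1}(f)=0$ and $\nu^{\ell+1}(f^{-1})=0$ if and only if there exist a variety $Y$ over $k$ and an isomorphism in codimension $\ell$, $\varphi\colon Y\dashrightarrow X$, such that $\varphi^{-1} f\varphi\in \operatorname{Psaut}^{\ell+1}(Y)$. -/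

import Mathlib

universe u

open CategoryTheory AlgebraicGeometry TopologicalSpace Filter Topology

noncomputable section

namespace CodimBir

/-- A variety over a field `k`: an integral separated scheme of finite type over `k`. -/
structure Variety (k : Type u) [Field k] where
  /-- The underlying scheme. -/
  scheme : Scheme.{u}
  /-- The structure morphism. -/
  str : scheme ⟶ Spec (CommRingCat.of k)
  isIntegral : IsIntegral scheme
  isSeparated : IsSeparated str
  locallyOfFiniteType : LocallyOfFiniteType str
  quasiCompact : QuasiCompact str

attribute [instance] Variety.isIntegral Variety.isSeparated Variety.locallyOfFiniteType
  Variety.quasiCompact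

variable {k : Type u} [Field k]

instance (X : Variety k) : X.scheme.Over (Spec (CommRingCat.of k)) := ⟨X.str⟩

/-- A birational map `X ⇢ Y` of varieties over `k`: a dominant rational map over `k` together with
its (unique) dominant rational inverse. The composition `RationalMap.comp` of Mathlib is written in
diagrammatic order. -/
@[ext]
structure BirMap (X Y : Variety k) where
  /-- The underlying rational map. -/
  hom : X.scheme ⤏ Y.scheme
  /-- The inverse rational map. -/
  inv : Y.scheme ⤏ X.scheme
  hom_isDominant : hom.IsDominant
  inv_isDominant : inv.IsDominant
  hom_isOver : hom.IsOver (Spec (CommRingCat.of k))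
  inv_isOver : inv.IsOver (Spec (CommRingCat.of k))
  hom_inv_id : hom.comp inv = Scheme.RationalMap.id X.scheme
  inv_hom_id : inv.comp hom = Scheme.RationalMap.id Y.scheme

namespace BirMap

attribute [instance] hom_isDominant inv_isDominant hom_isOver inv_isOver

variable {X Y Z : Variety k}

/-- The identity, as a birational map. -/
def refl (X : Variety k) : BirMap X X where
  hom := Scheme.RationalMap.id X.scheme
  inv := Scheme.RationalMap.id X.scheme
  hom_isDominant := inferInstance
  inv_isDominant := inferInstance
  hom_isOver := inferInstance
  inv_isOver := inferInstance
  hom_inv_id := Scheme.RationalMap.id_comp _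
  inv_hom_id := Scheme.RationalMap.id_comp _

/-- The inverse of a birational map. -/
def symm (f : BirMap X Y) : BirMap Y X where
  hom := f.inv
  inv := f.hom
  hom_isDominant := inferInstance
  inv_isDominant := inferInstance
  hom_isOver := inferInstance
  inv_isOver := inferInstance
  hom_inv_id := f.inv_hom_id
  inv_hom_id := f.hom_inv_id

/-- The composite `X ⇢ Y ⇢ Z`: first `f`, then `g`. -/
def trans (f : BirMap X Y) (g : BirMap Y Z) : BirMap X Z where
  hom := f.hom.comp g.hom
  inv := g.inv.comp f.inv
  hom_isDominant := inferInstance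
  inv_isDominant := inferInstance
  hom_isOver := inferInstance
  inv_isOver := inferInstance
  hom_inv_id := by
    rw [Scheme.RationalMap.comp_assoc, ← Scheme.RationalMap.comp_assoc g.hom]
    simp only [g.hom_inv_id, Scheme.RationalMap.id_comp, f.hom_inv_id]
  inv_hom_id := by
    rw [Scheme.RationalMap.comp_assoc, ← Scheme.RationalMap.comp_assoc f.inv]
    simp only [f.inv_hom_id, Scheme.RationalMap.id_comp, g.inv_hom_id]

end BirMap

/-- The group `Bir(X)` of birational transformations of `X`. -/
abbrev Bir (X : Variety k) : Type u := BirMap X X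

/-- The product `f * g` is `f ∘ g`: first `g`, then `f`. -/
instance (X : Variety k) : Group (Bir X) where
  mul f g := g.trans f
  one := BirMap.refl X
  inv f := f.symm
  mul_assoc f g h := BirMap.ext (Scheme.RationalMap.comp_assoc h.hom g.hom f.hom).symm
    (Scheme.RationalMap.comp_assoc f.inv g.inv h.inv)
  one_mul f := BirMap.ext (Scheme.RationalMap.comp_id f.hom) (Scheme.RationalMap.id_comp f.inv)
  mul_one f := BirMap.ext (Scheme.RationalMap.id_comp f.hom) (Scheme.RationalMap.comp_id f.inv)
  inv_mul_cancel f := BirMap.ext f.hom_inv_id f.hom_inv_id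

/-- The codimension of a closed subset `Z` of a topological space: the infimum, over all
irreducible closed `D ⊆ Z`, of the supremum of the lengths of chains of irreducible closed subsets
that start at `D`. The empty set has codimension `⊤`. -/
def codim {T : Type*} [TopologicalSpace T] (Z : Set T) : ℕ∞ :=
  ⨅ (D : IrreducibleCloseds T) (_ : (D : Set T) ⊆ Z), Order.coheight D

/-- The exceptional locus: the points without an open neighbourhood on which `f` is defined and
induces an isomorphism onto an open subscheme of `Y`. -/
def excLocus {X Y : Variety k} (f : BirMap X Y) : Set X.scheme :=
  {x | ¬ ∃ g : Scheme.PartialIso X.scheme Y.scheme, g.toRationalMap = f.hom ∧ x ∈ g.source}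

/-- `Exc^m(f)`: the irreducible components of codimension `m` of the exceptional locus of `f`. -/
def Exc {X Y : Variety k} (m : ℕ) (f : BirMap X Y) : Set (Set X.scheme) :=
  {D | (∃ C ∈ irreducibleComponents (excLocus f), D = Subtype.val '' C) ∧ codim D = m}

/-- `Exc^m(f)` is finite, so that `Set.ncard` is its cardinality. -/
theorem finite_Exc {X Y : Variety k} (m : ℕ) (f : BirMap X Y) : (Exc m f).Finite := by
  have h1 : IsLocallyNoetherian X.scheme := LocallyOfFiniteType.isLocallyNoetherian X.str
  have h2 : CompactSpace X.scheme := QuasiCompact.compactSpace_of_compactSpace X.str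
  have h3 : IsNoetherian X.scheme := {}
  have h4 : NoetherianSpace (excLocus f) := Topology.IsInducing.subtypeVal.noetherianSpace
  refine ((NoetherianSpace.finite_irreducibleComponents (α := excLocus f)).image
    (fun C => Subtype.val '' C)).subset ?_
  rintro D ⟨⟨C, hC, rfl⟩, -⟩
  exact ⟨C, hC, rfl⟩

/-- `f` is an isomorphism in codimension `l`: the exceptional loci of `f` and of its inverse have
codimension `> l`. -/
def IsIsoInCodim {X Y : Variety k} (l : ℕ) (f : BirMap X Y) : Prop :=
  (l : ℕ∞) < codim (excLocus f) ∧ (l : ℕ∞) < codim (excLocus f.symm)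

/-- `Psaut^l(X)`: the birational transformations of `X` that are isomorphisms in codimension `l`. -/
def Psaut (l : ℕ) (X : Variety k) : Set (Bir X) :=
  {f | IsIsoInCodim l f}

/-- The dynamical number `ν^m(f) = lim |Exc^m(f^n)| / n`. -/
def dynNumber {X : Variety k} (m : ℕ) (f : Bir X) : ℝ :=
  limUnder atTop (fun n : ℕ => ((Exc m (f ^ n)).ncard : ℝ) / n)

/-- The conjugate `φ⁻¹ ∘ f ∘ φ` of `f ∈ Bir(X)` by a birational map `φ : Y ⇢ X`. -/
def conj {X Y : Variety k} (φ : BirMap Y X) (f : Bir X) : Bir Y :=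
  (φ.trans f).trans φ.symm

end CodimBir

end

open CodimBir

/-! Identify points of birational models of X when the models agree near them; the classes are
germs. Bir(X) permutes germs by changing the marking of a model. Let T be the permutation given by
f, and A the set of germs of X at points of codimension ℓ+1. An isomorphism in codimension ℓ has no
exceptional points of codimension at most ℓ, so the exceptional components of codimension ℓ+1 are
the closures of the exceptional points of that codimension (`Exc_eq_image`). Hence |Exc^{ℓ+1}(f^n)|
= |T^n A \ A| (`germsOfCodim_sdiff`, `ncard_Exc_eq`), and both TA \ A and T⁻¹A \ A are finite.

The growth is then combinatorial. If a set B meets each T-orbit in nothing, in the whole orbit or in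
a half-line, then |T^n B \ B| = n|TB \ B| (`OrbitMonotone.ncard_succ`), and passing between A and a
set B at finite distance changes the counts by a bounded amount (`ncard_image_sdiff_le`). So if B is
the germ set of a model Y isomorphic to X in codimension ℓ, the sequence is nc + O(1), where c is
the number of exceptional components of the conjugate of f on Y. This gives (1), (2) and (3). For
(4), the vanishing of c for f and for f⁻¹ says exactly that the conjugate is an isomorphism in
codimension ℓ+1; conversely TB ⊆ B on any such model forces bounded growth.

It remains to realize such a B. Discarding finitely many germs of A leaves a set U for which U ∪ T^N
U is monotone (`exists_orbitMonotone`). The set U is realized by deleting closed subsets of X, and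
T^N U by the same variety with marking changed by f^N; the two models must be glued. A gluing is
separated when points related by the closure of the graph are already identified. If two related
points are both carried into X by one power of f, separatedness of X identifies them
(`Corr.eq_of_locIso`). The combinatorial choice of U provides this common power for all pairs in
codimension ℓ+1, so the bad pairs have a member of codimension > ℓ+1 and can be deleted harmlessly
(`exists_shrinking`). -/

noncomputable section

namespace CodimBir

open Scheme

/-! ### Rational maps and dominant open immersions -/

section RationalMaps

variable {W X Y Z : Scheme.{u}}

theorem isDominant_of_isOpenImmersion [Nonempty W] [PreirreducibleSpace X] (a : W ⟶ X)
    [IsOpenImmersion a] : IsDominant a :=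
  ⟨(a.isOpenEmbedding.isOpen_range.dense (Set.range_nonempty a))⟩

theorem toRationalMap_comp_toRationalMap [PreirreducibleSpace W] [IrreducibleSpace X]
    (a : W ⟶ X) [IsDominant a] (b : X ⟶ Y) :
    a.toRationalMap.comp b.toRationalMap = (a ≫ b).toRationalMap := by
  rw [RationalMap.comp_toRationalMap, ← RationalMap.compHom_toRationalMap,
    Hom.toPartialMap_compHom]

/-- The factorization `h` says that `p` maps its whole domain into `q.domain`, so composing does not
shrink the domain. -/
theorem comp_equiv_of_factors [PreirreducibleSpace X] [Nonempty Y] (p : X.PartialMap Y)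
    [IsDominant p.hom] (q : Y.PartialMap Z) (h : p.domain.toScheme ⟶ q.domain)
    (hh : h ≫ q.domain.ι = p.hom) :
    (p.comp q).equiv ⟨p.domain, p.dense_domain, h ≫ q.hom⟩ := by
  have e : p.domain ≤ p.domain.ι ''ᵁ p.hom ⁻¹ᵁ q.domain := by
    intro x hx
    have hz (z : p.domain.toScheme) : p.hom z ∈ q.domain := by
      rw [← hh, Scheme.Hom.comp_apply]
      exact (h z).2
    exact ⟨⟨x, hx⟩, hz ⟨x, hx⟩, rfl⟩
  refine ⟨p.domain, p.dense_domain, e, le_rfl, ?_⟩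
  have key : X.homOfLE e ≫ (p.domain.ι.isoImage (p.hom ⁻¹ᵁ q.domain)).inv ≫ p.hom ∣_ q.domain
      = h := by
    rw [← cancel_mono q.domain.ι]
    simp only [Category.assoc, morphismRestrict_ι, Scheme.Opens.isoImage_ι_inv_ι_assoc, hh]
    simp
  have key' := congrArg (· ≫ q.hom) key
  simp only [Category.assoc] at key'
  refine key'.trans ?_
  simp [PartialMap.restrict]

theorem toRationalMap_comp_of_factors [PreirreducibleSpace W] [Nonempty X] (a : W ⟶ X)
    [IsDominant a] (q : X.PartialMap Y) (e : W ⟶ q.domain) (h : e ≫ q.domain.ι = a) :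
    a.toRationalMap.comp q.toRationalMap = (e ≫ q.hom).toRationalMap := by
  rw [RationalMap.toRationalMap_comp, PartialMap.toRationalMap_eq_iff]
  refine (comp_equiv_of_factors a.toPartialMap q (W.topIso.hom ≫ e)
    ((Category.assoc _ _ _).trans (congrArg (W.topIso.hom ≫ ·) h))).trans ?_
  refine ⟨⊤, dense_univ, le_rfl, le_top, ?_⟩
  exact congrArg (W.homOfLE le_rfl ≫ ·) (Category.assoc W.topIso.hom e q.hom)

theorem toRationalMap_injective [IsReduced X] [Y.IsSeparated] {a b : X ⟶ Y}
    (h : a.toRationalMap = b.toRationalMap) : a = b := by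
  rw [PartialMap.toRationalMap_eq_iff] at h
  have := (PartialMap.equiv_toPartialMap_iff_of_isSeparated (S := ⊤_ _)).mp h
  exact (cancel_epi X.topIso.hom).mp this

/-- The rational inverse of a dominant open immersion. -/
theorem exists_rational_inverse [IrreducibleSpace W] [IrreducibleSpace X] (a : W ⟶ X)
    [IsOpenImmersion a] [IsDominant a] :
    ∃ (c : X ⤏ W) (_ : c.IsDominant), c.comp a.toRationalMap = RationalMap.id X ∧
      a.toRationalMap.comp c = RationalMap.id W := by
  let c : X.PartialMap W := ⟨a.opensRange, a.denseRange, a.isoOpensRange.inv⟩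
  have : IsDominant c.hom := by dsimp [c]; infer_instance
  refine ⟨c.toRationalMap, inferInstance, ?_, ?_⟩
  · rw [RationalMap.comp_toRationalMap, ← RationalMap.compHom_toRationalMap,
      PartialMap.toRationalMap_eq_iff]
    refine ⟨a.opensRange, a.denseRange, le_rfl, le_top, ?_⟩
    refine Eq.trans (b := a.opensRange.ι) ?_ (X.homOfLE_ι _).symm
    simp [c, PartialMap.restrict, PartialMap.compHom]
  · rw [toRationalMap_comp_of_factors a c a.isoOpensRange.hom a.isoOpensRange_hom_ι]
    simp [c]

theorem toRationalMap_comp_left_cancel [IrreducibleSpace W] [IrreducibleSpace X] [Nonempty Y]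
    (a : W ⟶ X) [IsOpenImmersion a] [IsDominant a] {f g : X ⤏ Y}
    (h : a.toRationalMap.comp f = a.toRationalMap.comp g) : f = g := by
  obtain ⟨c, _, hc, -⟩ := exists_rational_inverse a
  have key (f : X ⤏ Y) : c.comp (a.toRationalMap.comp f) = f := by
    rw [← RationalMap.comp_assoc]
    simp only [hc, RationalMap.id_comp]
  rw [← key f, ← key g, h]

end RationalMaps

end CodimBir

end

/-! ### Roofs and local isomorphisms of birational maps -/

noncomputable section

namespace CodimBir

open Scheme

variable {k : Type u} [Field k]

instance (X : Variety k) : X.scheme.IsSeparated where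
  isSeparated_terminal_from := by
    rw [← Limits.terminal.comp_from X.str]
    infer_instance

namespace BirMap

variable {X Y Z : Variety k}

theorem inv_unique {f g : BirMap X Y} (h : f.hom = g.hom) : f = g := by
  refine BirMap.ext h ?_
  have h1 : f.inv.comp (g.hom.comp g.inv) = f.inv := by rw [g.hom_inv_id, RationalMap.comp_id]
  have h2 : (f.inv.comp f.hom).comp g.inv = g.inv := by
    simp only [f.inv_hom_id, RationalMap.id_comp]
  rw [← h2, RationalMap.comp_assoc]
  simp only [h]
  exact h1.symm

/-- `a : W ⟶ X` and `b : W ⟶ Y` are open immersions which present `f` as `b ∘ a⁻¹`. -/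
structure IsRoof (f : BirMap X Y) {W : Scheme.{u}} (a : W ⟶ X.scheme) (b : W ⟶ Y.scheme) :
    Prop where
  integral : IsIntegral W
  left : IsOpenImmersion a
  right : IsOpenImmersion b
  dominant_left : IsDominant a
  dominant_right : IsDominant b
  comp_eq : a.toRationalMap.comp f.hom = b.toRationalMap

theorem IsRoof.of_nonempty (f : BirMap X Y) {W : Scheme.{u}} [Nonempty W] (a : W ⟶ X.scheme)
    (b : W ⟶ Y.scheme) [IsOpenImmersion a] [IsOpenImmersion b] [IsIntegral W] [IsDominant a]
    (h : a.toRationalMap.comp f.hom = b.toRationalMap) : f.IsRoof a b :=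
  ⟨inferInstance, inferInstance, inferInstance, inferInstance,
    isDominant_of_isOpenImmersion b, h⟩

/-- `f` induces an isomorphism from an open neighbourhood of `x` onto an open neighbourhood
of `y` that maps `x` to `y`. -/
def LocIso (f : BirMap X Y) (x : X.scheme) (y : Y.scheme) : Prop :=
  ∃ (W : Scheme.{u}) (a : W ⟶ X.scheme) (b : W ⟶ Y.scheme), f.IsRoof a b ∧
    ∃ w, a w = x ∧ b w = y

theorem IsRoof.symm {f : BirMap X Y} {W : Scheme.{u}} {a : W ⟶ X.scheme} {b : W ⟶ Y.scheme}
    (h : f.IsRoof a b) : f.symm.IsRoof b a := by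
  obtain ⟨_, _, _, _, _, h⟩ := h
  refine ⟨inferInstance, inferInstance, inferInstance, inferInstance, inferInstance, ?_⟩
  change b.toRationalMap.comp f.inv = _
  simp only [← h]
  rw [RationalMap.comp_assoc, f.hom_inv_id, RationalMap.comp_id]

theorem LocIso.symm {f : BirMap X Y} {x y} (h : f.LocIso x y) : f.symm.LocIso y x := by
  obtain ⟨W, a, b, h, w, hx, hy⟩ := h
  exact ⟨W, b, a, h.symm, w, hy, hx⟩

@[simp] theorem symm_symm (f : BirMap X Y) : f.symm.symm = f := rfl

theorem locIso_symm {f : BirMap X Y} {x y} : f.symm.LocIso y x ↔ f.LocIso x y :=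
  ⟨LocIso.symm, LocIso.symm⟩

theorem isRoof_id (X : Variety k) : (BirMap.refl X).IsRoof (𝟙 X.scheme) (𝟙 X.scheme) :=
  ⟨inferInstance, inferInstance, inferInstance, inferInstance, inferInstance,
    RationalMap.comp_id _⟩

theorem locIso_refl (x : X.scheme) : (BirMap.refl X).LocIso x x :=
  ⟨X.scheme, 𝟙 _, 𝟙 _, isRoof_id X, x, rfl, rfl⟩

theorem LocIso.eq_of_refl {x y : X.scheme} (h : (BirMap.refl X).LocIso x y) : x = y := by
  obtain ⟨W, a, b, ⟨_, _, _, _, _, h⟩, w, rfl, rfl⟩ := h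
  rw [toRationalMap_injective ((RationalMap.comp_id _).symm.trans h)]

theorem IsRoof.trans {f : BirMap X Y} {g : BirMap Y Z} {V W T : Scheme.{u}} {a : V ⟶ X.scheme}
    {b : V ⟶ Y.scheme} {c : W ⟶ Y.scheme} {d : W ⟶ Z.scheme} (hf : f.IsRoof a b)
    (hg : g.IsRoof c d) (p : T ⟶ V) (q : T ⟶ W) [IsOpenImmersion p] [IsOpenImmersion q]
    [Nonempty T] (h : p ≫ b = q ≫ c) : (f.trans g).IsRoof (p ≫ a) (q ≫ d) := by
  obtain ⟨_, _, _, _, _, hf⟩ := hf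
  obtain ⟨_, _, _, _, _, hg⟩ := hg
  have := isDominant_of_isOpenImmersion p
  have := isDominant_of_isOpenImmersion q
  have : IsIntegral T := isIntegral_of_isOpenImmersion p
  refine ⟨inferInstance, inferInstance, inferInstance, inferInstance, inferInstance, ?_⟩
  change (p ≫ a).toRationalMap.comp (f.hom.comp g.hom) = _
  rw [← toRationalMap_comp_toRationalMap q d, ← hg, ← RationalMap.comp_assoc,
    ← RationalMap.comp_assoc]
  congr 1
  rw [toRationalMap_comp_toRationalMap q c]
  simp only [← h]
  simp only [← toRationalMap_comp_toRationalMap]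
  rw [RationalMap.comp_assoc, hf]

/-- The fibre product over `Y` of two roofs is a roof of the composite, and it has a point above any
two points with the same image in `Y`. -/
theorem LocIso.trans {f : BirMap X Y} {g : BirMap Y Z} {x y z} (hf : f.LocIso x y)
    (hg : g.LocIso y z) : (f.trans g).LocIso x z := by
  obtain ⟨V, a, b, hf, v, rfl, rfl⟩ := hf
  obtain ⟨W, c, d, hg, w, hw, rfl⟩ := hg
  have := hf.right
  have := hg.left
  obtain ⟨t, rfl, rfl⟩ := Scheme.Pullback.exists_preimage_pullback v w hw.symm
  have : Nonempty (Limits.pullback b c : Scheme) := ⟨t⟩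
  exact ⟨_, _, _, hf.trans hg (Limits.pullback.fst b c) (Limits.pullback.snd b c)
    Limits.pullback.condition, t, by simp, by simp⟩

@[simp] theorem trans_symm_self (f : BirMap X Y) : f.trans f.symm = BirMap.refl X :=
  BirMap.ext f.hom_inv_id f.hom_inv_id

@[simp] theorem symm_trans_self (f : BirMap X Y) : f.symm.trans f = BirMap.refl Y :=
  BirMap.ext f.inv_hom_id f.inv_hom_id

theorem trans_assoc {T : Variety k} (f : BirMap X Y) (g : BirMap Y Z) (h : BirMap Z T) :
    (f.trans g).trans h = f.trans (g.trans h) :=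
  BirMap.ext (RationalMap.comp_assoc _ _ _) (RationalMap.comp_assoc _ _ _).symm

@[simp] theorem refl_trans (f : BirMap X Y) : (BirMap.refl X).trans f = f :=
  BirMap.ext (RationalMap.id_comp _) (RationalMap.comp_id _)

@[simp] theorem trans_refl (f : BirMap X Y) : f.trans (BirMap.refl Y) = f :=
  BirMap.ext (RationalMap.comp_id _) (RationalMap.id_comp _)

theorem trans_symm_rev (f : BirMap X Y) (g : BirMap Y Z) :
    (f.trans g).symm = g.symm.trans f.symm := rfl

theorem LocIso.coheight_eq {f : BirMap X Y} {x y} (h : f.LocIso x y) :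
    Order.coheight x = Order.coheight y := by
  obtain ⟨W, a, b, ⟨_, _, _, _, _, _⟩, w, rfl, rfl⟩ := h
  rw [coheight_eq_of_isOpenImmersion a, coheight_eq_of_isOpenImmersion b]

theorem isRoof_of_partialIso {f : BirMap X Y} (p : X.scheme.PartialIso Y.scheme)
    (hp : p.toRationalMap = f.hom) : f.IsRoof p.source.ι (p.iso.hom ≫ p.target.ι) := by
  have : Nonempty p.source := p.dense_source.nonempty.to_subtype
  have := Opens.isDominant_ι p.dense_source
  have := Opens.isDominant_ι p.dense_target
  refine ⟨inferInstance, inferInstance, inferInstance, inferInstance, inferInstance, ?_⟩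
  simp only [← hp]
  exact (toRationalMap_comp_of_factors p.source.ι p.toPartialMap (𝟙 _) (Category.id_comp _)).trans
    (congrArg _ (Category.id_comp _))

theorem IsRoof.exists_partialIso {f : BirMap X Y} {W : Scheme.{u}} {a : W ⟶ X.scheme}
    {b : W ⟶ Y.scheme} (h : f.IsRoof a b) : ∃ p : X.scheme.PartialIso Y.scheme,
      p.toRationalMap = f.hom ∧ p.source = Set.range a := by
  obtain ⟨_, _, _, _, _, h⟩ := h
  let p : X.scheme.PartialIso Y.scheme :=
    ⟨a.opensRange, a.denseRange, b.opensRange, b.denseRange,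
      a.isoOpensRange.symm ≪≫ b.isoOpensRange⟩
  refine ⟨p, ?_, rfl⟩
  apply toRationalMap_comp_left_cancel a
  rw [h]
  refine (toRationalMap_comp_of_factors a p.toPartialMap a.isoOpensRange.hom
    a.isoOpensRange_hom_ι).trans ?_
  have : a.isoOpensRange.hom ≫ (a.isoOpensRange.inv ≫ b.isoOpensRange.hom) ≫
      b.opensRange.ι = b := by simp
  exact congrArg _ this

/-- Trades partial isomorphisms for roofs, which compose by fibre products and remember the image
point. -/
theorem mem_excLocus {f : BirMap X Y} {x} : x ∈ excLocus f ↔ ∀ y, ¬ f.LocIso x y := by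
  rw [← not_exists]
  refine not_congr ⟨?_, ?_⟩
  · rintro ⟨p, hp, hx⟩
    exact ⟨_, _, _, _, isRoof_of_partialIso p hp, ⟨x, hx⟩, rfl, rfl⟩
  · rintro ⟨y, W, a, b, h, w, rfl, rfl⟩
    obtain ⟨p, hp, hs⟩ := h.exists_partialIso
    refine ⟨p, hp, ?_⟩
    change a w ∈ (p.source : Set X.scheme)
    rw [hs]
    exact ⟨w, rfl⟩

theorem isClosed_excLocus (f : BirMap X Y) : IsClosed (excLocus f) := by
  rw [← isOpen_compl_iff, isOpen_iff_forall_mem_open]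
  intro x hx
  obtain ⟨p, hp, hx⟩ := not_not.mp hx
  exact ⟨p.source, fun y hy => not_not.mpr ⟨p, hp, hy⟩, p.source.2, hx⟩

end BirMap

end CodimBir

end

/-! ### Codimension and exceptional components in terms of points -/

noncomputable section

namespace CodimBir

open Scheme

section Codim

variable {X : Scheme.{u}}

theorem coheight_closure_singleton (x : X) :
    Order.coheight (⟨closure {x}, isIrreducible_singleton.closure, isClosed_closure⟩ :
      IrreducibleCloseds X) = Order.coheight x :=
  Order.coheight_orderIso (irreducibleSetEquivPoints (α := X)).symm x

theorem exists_closure_singleton_eq (D : IrreducibleCloseds X) :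
    ∃ x : X, (D : Set X) = closure {x} ∧ Order.coheight D = Order.coheight x := by
  refine ⟨irreducibleSetEquivPoints D, ?_, (Order.coheight_orderIso _ _).symm⟩
  rw [← coe_irreducibleEquivPoints_symm_apply, OrderIso.symm_apply_apply]

/-- Irreducible closed sets of a scheme have unique generic points. In the specialization order (`x
≤ y` means `y ⤳ x`) the coheight of a point is the codimension of its closure. -/
theorem lt_codim_iff {Z : Set X} (hZ : IsClosed Z) (l : ℕ) :
    (l : ℕ∞) < codim Z ↔ ∀ x ∈ Z, (l : ℕ∞) < Order.coheight x := by
  constructor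
  · intro h x hx
    refine h.trans_le ?_
    rw [← coheight_closure_singleton]
    exact iInf₂_le (⟨closure {x}, isIrreducible_singleton.closure, isClosed_closure⟩ :
      IrreducibleCloseds X) (closure_minimal (Set.singleton_subset_iff.mpr hx) hZ)
  · intro h
    rw [← ENat.add_one_le_iff (ENat.natCast_ne_top l)]
    refine le_iInf₂ fun D hD => ?_
    obtain ⟨x, hx, hc⟩ := exists_closure_singleton_eq D
    rw [ENat.add_one_le_iff (ENat.natCast_ne_top l), hc]
    exact h x (hD (hx ▸ subset_closure rfl))

theorem codim_closure_singleton (x : X) : codim (closure {x}) = Order.coheight x := by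
  rw [← coheight_closure_singleton]
  refine le_antisymm ?_ (le_iInf₂ fun D hD => Order.coheight_anti hD)
  exact iInf₂_le (⟨closure {x}, isIrreducible_singleton.closure, isClosed_closure⟩ :
      IrreducibleCloseds X) (Set.Subset.refl (closure {x}))

end Codim

variable {k : Type u} [Field k] {X Y Z : Variety k}

open BirMap

theorem isIsoInCodim_iff {l : ℕ} {f : BirMap X Y} : IsIsoInCodim l f ↔
    (∀ x : X.scheme, Order.coheight x ≤ l → ∃ y, f.LocIso x y) ∧
      ∀ y : Y.scheme, Order.coheight y ≤ l → ∃ x, f.LocIso x y := by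
  rw [IsIsoInCodim, lt_codim_iff f.isClosed_excLocus, lt_codim_iff f.symm.isClosed_excLocus]
  simp only [mem_excLocus, locIso_symm, ← not_le]
  refine and_congr (forall_congr' fun x => ?_) (forall_congr' fun x => ?_)
  all_goals
    push Not
    exact ⟨fun h hx => by_contra fun hn => absurd hx (h (not_exists.mp hn)).not_ge,
      fun h hn => lt_of_not_ge fun hx => (h hx).elim hn⟩

theorem IsIsoInCodim.symm {l : ℕ} {f : BirMap X Y} (h : IsIsoInCodim l f) :
    IsIsoInCodim l f.symm := ⟨h.2, h.1⟩

theorem IsIsoInCodim.trans {l : ℕ} {f : BirMap X Y} {g : BirMap Y Z} (hf : IsIsoInCodim l f)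
    (hg : IsIsoInCodim l g) : IsIsoInCodim l (f.trans g) := by
  rw [isIsoInCodim_iff] at *
  constructor
  · intro x hx
    obtain ⟨y, hy⟩ := hf.1 x hx
    obtain ⟨z, hz⟩ := hg.1 y (hy.coheight_eq ▸ hx)
    exact ⟨z, hy.trans hz⟩
  · intro z hz
    obtain ⟨y, hy⟩ := hg.2 z hz
    obtain ⟨x, hx⟩ := hf.2 y (hy.coheight_eq ▸ hz)
    exact ⟨x, hx.trans hy⟩

theorem isIsoInCodim_refl (l : ℕ) (X : Variety k) : IsIsoInCodim l (BirMap.refl X) :=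
  isIsoInCodim_iff.mpr ⟨fun x _ => ⟨x, locIso_refl x⟩, fun x _ => ⟨x, locIso_refl x⟩⟩

/-- Every point of the exceptional locus has codimension at least `l + 1`. A point of codimension
exactly `l + 1` therefore has no proper generization inside the locus, so it is the generic point of
a component. -/
theorem Exc_eq_image {l : ℕ} {f : BirMap X Y} (h : IsIsoInCodim l f) :
    Exc (l + 1) f = (fun x => closure {x}) ''
      {x | x ∈ excLocus f ∧ Order.coheight x = (l + 1 : ℕ)} := by
  have hE := f.isClosed_excLocus
  have hl := (lt_codim_iff hE l).mp h.1
  have key (C) (hC : C ∈ irreducibleComponents (excLocus f)) :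
      ∃ c ∈ excLocus f, Subtype.val '' C = closure {c} := by
    obtain ⟨c, hc, -⟩ := exists_closure_singleton_eq (⟨Subtype.val '' C,
      hC.1.image _ continuous_subtype_val.continuousOn,
      hE.isClosedMap_subtype_val _ (isClosed_of_mem_irreducibleComponents _ hC)⟩ :
        IrreducibleCloseds X.scheme)
    have hc' : Subtype.val '' C = closure {c} := hc
    refine ⟨c, ?_, hc⟩
    have : c ∈ Subtype.val '' C := hc' ▸ subset_closure rfl
    obtain ⟨d, -, rfl⟩ := this
    exact d.2
  ext D
  constructor
  · rintro ⟨⟨C, hC, rfl⟩, hD⟩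
    obtain ⟨c, hcE, hc⟩ := key C hC
    refine ⟨c, ⟨hcE, ?_⟩, hc.symm⟩
    rw [← codim_closure_singleton, ← hc, hD]
  · rintro ⟨x, ⟨hxE, hx⟩, rfl⟩
    obtain ⟨c, hcE, hc⟩ := key _ (irreducibleComponent_mem_irreducibleComponents
      (⟨x, hxE⟩ : excLocus f))
    have hcx : x ≤ c := by
      change c ⤳ x
      rw [specializes_iff_mem_closure, ← hc]
      exact ⟨_, mem_irreducibleComponent, rfl⟩
    have : x = c := by
      by_contra hne
      have hlt : x < c := 
        lt_of_le_not_ge hcx fun h : x ⤳ c => hne (h.antisymm hcx).eq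
      have h1 := Order.coheight_add_one_le hlt
      have h2 := hl c hcE
      rw [hx] at h1
      rw [← ENat.add_one_le_iff (ENat.natCast_ne_top l)] at h2
      have h3 := (add_le_add_left h2 1).trans h1
      norm_cast at h3
      omega
    subst this
    exact ⟨⟨_, irreducibleComponent_mem_irreducibleComponents _, hc.symm⟩, by
      rw [codim_closure_singleton, hx]⟩

theorem closure_singleton_injective (X : Scheme.{u}) :
    Function.Injective (fun x : X => closure ({x} : Set X)) := fun x y h => by
  exact (inseparable_iff_closure_eq.mpr h).eq

theorem ncard_Exc {l : ℕ} {f : BirMap X Y} (h : IsIsoInCodim l f) :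
    (Exc (l + 1) f).ncard =
      {x : X.scheme | x ∈ excLocus f ∧ Order.coheight x = (l + 1 : ℕ)}.ncard := by
  rw [Exc_eq_image h, Set.ncard_image_of_injective _ (closure_singleton_injective _)]

theorem finite_excLocus_coheight {l : ℕ} {f : BirMap X Y} (h : IsIsoInCodim l f) :
    {x : X.scheme | x ∈ excLocus f ∧ Order.coheight x = (l + 1 : ℕ)}.Finite := by
  refine Set.Finite.of_finite_image ?_ (closure_singleton_injective _).injOn
  rw [← Exc_eq_image h]
  exact finite_Exc _ _

end CodimBir

end

/-! ### Open subvarieties and the closure of the graph -/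

noncomputable section

namespace CodimBir

open Scheme

variable {k : Type u} [Field k] {X Y Z : Variety k}

namespace BirMap

theorem IsRoof.comp_hom_of_factors {f : BirMap X Y} {V W : Scheme.{u}} {a : W ⟶ X.scheme}
    {b : W ⟶ Y.scheme} (h : f.IsRoof a b) [IrreducibleSpace V] (t : V ⟶ W) (d : V ⟶ X.scheme)
    [IsDominant d] (hd : t ≫ a = d) : d.toRationalMap.comp f.hom = (t ≫ b).toRationalMap := by
  subst hd
  obtain ⟨_, _, _, _, _, h⟩ := h
  have : IsDominant t := IsDominant.of_comp_of_isOpenImmersion t a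
  simp only [← toRationalMap_comp_toRationalMap]
  rw [RationalMap.comp_assoc, h]

theorem IsRoof.over {f : BirMap X Y} {W : Scheme.{u}} {a : W ⟶ X.scheme} {b : W ⟶ Y.scheme}
    (h : f.IsRoof a b) : a ≫ X.str = b ≫ Y.str := by
  obtain ⟨_, _, _, _, _, h⟩ := h
  apply toRationalMap_injective
  have h1 : f.hom.comp Y.str.toRationalMap = X.str.toRationalMap := by
    rw [RationalMap.comp_toRationalMap]
    exact RationalMap.isOver_iff.mp f.hom_isOver
  have : Nonempty (Spec (CommRingCat.of k)) := ⟨X.str (genericPoint X.scheme)⟩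
  have : IrreducibleSpace (Spec (CommRingCat.of k)) := inferInstance
  rw [← toRationalMap_comp_toRationalMap, ← toRationalMap_comp_toRationalMap, ← h1]
  simp only [← h]
  rw [RationalMap.comp_assoc]

/-- An open immersion over `k`, as a birational map. -/
theorem exists_isRoof_of_isOpenImmersion (j : X.scheme ⟶ Y.scheme) [IsOpenImmersion j]
    (hj : j ≫ Y.str = X.str) : ∃ f : BirMap X Y, f.IsRoof (𝟙 _) j := by
  have := isDominant_of_isOpenImmersion j
  obtain ⟨c, hc, h1, h2⟩ := exists_rational_inverse j
  have hjo : j.toRationalMap.compHom Y.str = X.str.toRationalMap := by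
    rw [← RationalMap.compHom_toRationalMap, Hom.toPartialMap_compHom, hj]
  have : Nonempty (Spec (CommRingCat.of k)) := ⟨X.str (genericPoint X.scheme)⟩
  have hco : c.compHom X.str = Y.str.toRationalMap := by
    rw [← RationalMap.comp_toRationalMap, ← hjo, ← RationalMap.comp_toRationalMap,
      ← RationalMap.comp_assoc]
    simp only [h1, RationalMap.id_comp]
  exact ⟨⟨j.toRationalMap, c, inferInstance, hc, RationalMap.isOver_iff.mpr hjo,
    RationalMap.isOver_iff.mpr hco, h2, h1⟩, inferInstance, inferInstance, inferInstance,
    inferInstance, inferInstance, RationalMap.id_comp _⟩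

theorem IsRoof.locIso {f : BirMap X Y} {W : Scheme.{u}} {a : W ⟶ X.scheme} {b : W ⟶ Y.scheme}
    (h : f.IsRoof a b) (w : W) : f.LocIso (a w) (b w) :=
  ⟨W, a, b, h, w, rfl, rfl⟩

end BirMap

open BirMap Limits

instance (X : Variety k) : IsLocallyNoetherian X.scheme :=
  LocallyOfFiniteType.isLocallyNoetherian X.str

/-- The complement of a proper closed subset is again a variety. -/
theorem exists_removal (X : Variety k) (C : Set X.scheme) (hC : IsClosed C) (hne : Cᶜ.Nonempty) :
    ∃ (X₀ : Variety k) (j : X₀.scheme ⟶ X.scheme) (_ : IsOpenImmersion j) (ι : BirMap X₀ X),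
      ι.IsRoof (𝟙 _) j ∧ Set.range j = Cᶜ := by
  let U : X.scheme.Opens := ⟨Cᶜ, hC.isOpen_compl⟩
  have : Nonempty U := hne.to_subtype
  let X₀ : Variety k :=
    { scheme := U
      str := U.ι ≫ X.str
      isIntegral := inferInstance
      isSeparated := inferInstance
      locallyOfFiniteType := inferInstance
      quasiCompact := inferInstance }
  let j : X₀.scheme ⟶ X.scheme := U.ι
  have : IsOpenImmersion j := inferInstanceAs (IsOpenImmersion U.ι)
  obtain ⟨ι, hι⟩ := exists_isRoof_of_isOpenImmersion (X := X₀) j rfl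
  exact ⟨X₀, j, inferInstance, ι, hι, U.range_ι⟩

/-- The graph of the maximal isomorphism between open subsets induced by `f`. -/
def graph (f : BirMap X Y) : Set (pullback X.str Y.str : Scheme) :=
  {e | ∃ (W : Scheme.{u}) (j : W ⟶ pullback X.str Y.str),
    f.IsRoof (j ≫ pullback.fst _ _) (j ≫ pullback.snd _ _) ∧ e ∈ Set.range j}

/-- The pair `(x, y)` lies under the closure of the graph of `f`. -/
def Corr (f : BirMap X Y) (x : X.scheme) (y : Y.scheme) : Prop :=
  ∃ e ∈ closure (graph f), pullback.fst X.str Y.str e = x ∧ pullback.snd X.str Y.str e = y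

/-- Near a point `e` above `(x, y)`, `α` and `β` give two morphisms from the product to `Z`. They
agree on the graph since `α` is `β` after `f`; as `Z` is separated, they agree on its closure, in
particular at `e`. -/
theorem Corr.eq_of_locIso {f : BirMap X Y} {x y} (h : Corr f x y) {α : BirMap X Z} {β : BirMap Y Z}
    (hαβ : α = f.trans β) {z z'} (hz : α.LocIso x z) (hz' : β.LocIso y z') : z = z' := by
  obtain ⟨e, he, rfl, rfl⟩ := h
  obtain ⟨V, a, c, hα, v, hv, rfl⟩ := hz
  obtain ⟨V', b, d, hβ, v', hv', rfl⟩ := hz'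
  have := hα.left
  have := hβ.left
  let P := pullback X.str Y.str
  let p : P ⟶ X.scheme := pullback.fst _ _
  let q : P ⟶ Y.scheme := pullback.snd _ _
  let T : P.Opens := p ⁻¹ᵁ a.opensRange ⊓ q ⁻¹ᵁ b.opensRange
  have hT (t : T) : p t.1 ∈ Set.range a ∧ q t.1 ∈ Set.range b := t.2
  let s : T.toScheme ⟶ V := IsOpenImmersion.lift a (T.ι ≫ p) (by
    rintro _ ⟨t, rfl⟩; rw [Scheme.Hom.comp_apply]; exact (hT t).1)
  let s' : T.toScheme ⟶ V' := IsOpenImmersion.lift b (T.ι ≫ q) (by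
    rintro _ ⟨t, rfl⟩; rw [Scheme.Hom.comp_apply]; exact (hT t).2)
  have hs : s ≫ a = T.ι ≫ p := IsOpenImmersion.lift_fac _ _ _
  have hs' : s' ≫ b = T.ι ≫ q := IsOpenImmersion.lift_fac _ _ _
  let E : Set T.toScheme := Set.range (equalizer.ι (s ≫ c) (s' ≫ d))
  have hE : IsClosed E := (equalizer.ι (s ≫ c) (s' ≫ d)).isClosedEmbedding.isClosed_range
  -- On a roof of `f` restricted to `T`, both morphisms to `Z` represent one rational map. The
  -- source is reduced and `Z` separated, so they are equal and the roof factors through the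
  -- equalizer.
  have hgr : T.ι ⁻¹' graph f ⊆ E := by
    rintro t ⟨W, j, hj, w, hw⟩
    have := hj.integral
    have := hj.left
    have := hj.dominant_left
    have := hj.dominant_right
    let W' : W.Opens := j ⁻¹ᵁ T
    obtain ⟨w', hw'⟩ : ∃ w' : W'.toScheme, W'.ι w' = w :=
      ⟨⟨w, show j w ∈ T from hw ▸ t.2⟩, rfl⟩
    have : Nonempty W' := ⟨w'⟩
    have := isDominant_of_isOpenImmersion W'.ι
    let j' : W'.toScheme ⟶ T := j ∣_ T
    have hj' : j' ≫ T.ι = W'.ι ≫ j := morphismRestrict_ι j T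
    have e1 := hα.comp_hom_of_factors (j' ≫ s) (W'.ι ≫ j ≫ p) (by
      rw [Category.assoc, hs, reassoc_of% hj'])
    have e2 := hβ.comp_hom_of_factors (j' ≫ s') (W'.ι ≫ j ≫ q) (by
      rw [Category.assoc, hs', reassoc_of% hj'])
    have e3 := hj.comp_hom_of_factors W'.ι (W'.ι ≫ j ≫ p) rfl
    have e4 : (W'.ι ≫ j ≫ p).toRationalMap.comp α.hom =
        (W'.ι ≫ j ≫ q).toRationalMap.comp β.hom := by
      rw [hαβ]
      change RationalMap.comp _ (f.hom.comp β.hom) = _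
      rw [← RationalMap.comp_assoc]
      congr 1
    have e5 : j' ≫ s ≫ c = j' ≫ s' ≫ d := by
      rw [← Category.assoc, ← Category.assoc]
      exact toRationalMap_injective (e1.symm.trans (e4.trans e2))
    refine ⟨equalizer.lift j' e5 w', ?_⟩
    rw [← Scheme.Hom.comp_apply, equalizer.lift_ι]
    apply T.ι.isOpenEmbedding.injective
    rw [← Scheme.Hom.comp_apply, hj', Scheme.Hom.comp_apply, hw', hw]
  have heT : e ∈ T := ⟨⟨v, hv⟩, ⟨v', hv'⟩⟩
  obtain ⟨t, ht⟩ : ∃ t : T.toScheme, T.ι t = e := ⟨⟨e, heT⟩, rfl⟩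
  have h1 : t ∈ closure (T.ι ⁻¹' graph f) := by
    rw [← T.ι.isOpenEmbedding.isOpenMap.preimage_closure_eq_closure_preimage T.ι.continuous]
    rwa [Set.mem_preimage, ht]
  obtain ⟨r, hr⟩ := closure_minimal hgr hE h1
  have h2 : (s ≫ c) t = (s' ≫ d) t := by
    rw [← hr, ← Scheme.Hom.comp_apply, equalizer.condition, Scheme.Hom.comp_apply]
  have h3 : s t = v := a.isOpenEmbedding.injective (by
    rw [← Scheme.Hom.comp_apply, hs, hv, Scheme.Hom.comp_apply, ht])
  have h4 : s' t = v' := b.isOpenEmbedding.injective (by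
    rw [← Scheme.Hom.comp_apply, hs', hv', Scheme.Hom.comp_apply, ht])
  rwa [Scheme.Hom.comp_apply, Scheme.Hom.comp_apply, h3, h4] at h2

end CodimBir

end

/-! ### Separating points by shrinking, and the maximal isomorphism -/

noncomputable section

namespace CodimBir

open Scheme BirMap Limits

variable {k : Type u} [Field k] {X Y Z : Variety k}

theorem Corr.eq_right {f : BirMap X Y} {x y z} (h : Corr f x y) (hz : f.LocIso x z) : z = y :=
  h.eq_of_locIso (trans_refl f).symm hz (locIso_refl y)

theorem Corr.eq_left {f : BirMap X Y} {x y z} (h : Corr f x y) (hz : f.LocIso z y) : x = z :=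
  h.eq_of_locIso (trans_symm_self f).symm (locIso_refl x) hz.symm

/-- After `f`, the points `x` and `y` both lie on some common variety. -/
def Compat (f : BirMap X Y) (x : X.scheme) (y : Y.scheme) : Prop :=
  ∃ (Z : Variety k) (α : BirMap X Z) (β : BirMap Y Z), α = f.trans β ∧
    (∃ z, α.LocIso x z) ∧ ∃ z, β.LocIso y z

/-- The images of `x` and `y` on the common variety coincide, so going there by `α` and back by the
inverse of `β` is a local isomorphism, and this composite is `f`. -/
theorem Corr.locIso_of_compat {f : BirMap X Y} {x y} (h : Corr f x y) (hc : Compat f x y) :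
    f.LocIso x y := by
  obtain ⟨Z, α, β, hαβ, ⟨z, hz⟩, z', hz'⟩ := hc
  obtain rfl := h.eq_of_locIso hαβ hz hz'
  have := hz.trans hz'.symm
  rwa [hαβ, trans_assoc, trans_symm_self, trans_refl] at this

/-- If neither codimension exceeds `l + 1`, then either one is at most `l`, where `f` or its inverse
is a local isomorphism and `Corr` fixes the partner, or both equal `l + 1` and compatibility
applies. In each case `x` would not be exceptional. -/
theorem Corr.exc_coheight {l : ℕ} {f : BirMap X Y} (hf : IsIsoInCodim l f)
    (hc : ∀ x y, Order.coheight x = (l + 1 : ℕ) → Order.coheight y = (l + 1 : ℕ) → Compat f x y)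
    {x y} (h : Corr f x y) (hx : x ∈ excLocus f) :
    ((l + 1 : ℕ) : ℕ∞) < Order.coheight x ∨ ((l + 1 : ℕ) : ℕ∞) < Order.coheight y := by
  have step {c : ℕ∞} (hc : ¬ c ≤ l) (hc' : ¬ ((l + 1 : ℕ) : ℕ∞) < c) : c = (l + 1 : ℕ) := by
    refine le_antisymm (not_lt.mp hc') ?_
    push_cast
    rw [ENat.add_one_le_iff (ENat.natCast_ne_top l)]
    exact not_le.mp hc
  rw [mem_excLocus] at hx
  rw [isIsoInCodim_iff] at hf
  by_contra! hn
  refine hx y (h.locIso_of_compat (hc x y (step ?_ hn.1.not_gt) (step ?_ hn.2.not_gt)))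
  · intro hl
    obtain ⟨z, hz⟩ := hf.1 x hl
    exact hx z hz
  · intro hl
    obtain ⟨z, hz⟩ := hf.2 y hl
    obtain rfl := h.eq_left hz
    exact hx y hz

theorem coheight_le_of_mem_closure {X : Scheme.{u}} {x y : X} (h : y ∈ closure {x}) :
    Order.coheight x ≤ Order.coheight y :=
  Order.coheight_anti (show y ≤ x from specializes_iff_mem_closure.mpr h)

/-- Compatible pairs of points can be separated by removing closed sets of high codimension. -/
theorem exists_shrinking {l : ℕ} {f : BirMap X Y} (hf : IsIsoInCodim l f)
    (hc : ∀ x y, Order.coheight x = (l + 1 : ℕ) → Order.coheight y = (l + 1 : ℕ) →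
      Compat f x y) :
    ∃ (C : Set X.scheme) (D : Set Y.scheme), IsClosed C ∧ IsClosed D ∧
      (∀ x ∈ C, ((l + 1 : ℕ) : ℕ∞) < Order.coheight x) ∧
      (∀ y ∈ D, ((l + 1 : ℕ) : ℕ∞) < Order.coheight y) ∧
      ∀ x ∉ C, ∀ y ∉ D, Corr f x y → f.LocIso x y := by
  let P := pullback X.str Y.str
  let p : P ⟶ X.scheme := pullback.fst _ _
  let q : P ⟶ Y.scheme := pullback.snd _ _
  have : CompactSpace P := QuasiCompact.compactSpace_of_compactSpace (p ≫ X.str)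
  have : IsLocallyNoetherian P := LocallyOfFiniteType.isLocallyNoetherian (p ≫ X.str)
  have : IsNoetherian P := {}
  -- The bad locus: related pairs whose first member is exceptional. It has finitely many
  -- irreducible components, and each generic point `e D` projects to codimension greater than `l +
  -- 1` on at least one side; the closure of that projection is removed.
  let E : Set P := closure (graph f) ∩ p ⁻¹' excLocus f
  have hE : IsClosed E := isClosed_closure.inter (f.isClosed_excLocus.preimage p.continuous)
  obtain ⟨S, hS, hSc, hSi, hSE⟩ := NoetherianSpace.exists_finite_set_isClosed_irreducible hE
  have hgen : ∀ D ∈ S, ∃ e : P, D = closure {e} := fun D hD => by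
    obtain ⟨e, he, -⟩ := exists_closure_singleton_eq (⟨D, hSi D hD, hSc D hD⟩ :
      IrreducibleCloseds P)
    exact ⟨e, he⟩
  choose! e he using hgen
  have heE : ∀ D ∈ S, e D ∈ E := fun D hD => by
    rw [hSE]
    exact ⟨D, hD, (Set.ext_iff.mp (he D hD) _).mpr (subset_closure rfl)⟩
  let S₁ : Set (Set P) := {D ∈ S | ((l + 1 : ℕ) : ℕ∞) < Order.coheight (p (e D))}
  let S₂ : Set (Set P) := {D ∈ S | ((l + 1 : ℕ) : ℕ∞) < Order.coheight (q (e D))}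
  refine ⟨⋃ D ∈ S₁, closure {p (e D)}, ⋃ D ∈ S₂, closure {q (e D)},
    (hS.subset fun D hD => hD.1).isClosed_biUnion fun _ _ => isClosed_closure,
    (hS.subset fun D hD => hD.1).isClosed_biUnion fun _ _ => isClosed_closure, ?_, ?_, ?_⟩
  · intro x hx
    simp only [Set.mem_iUnion] at hx
    obtain ⟨D, hD, hx⟩ := hx
    exact hD.2.trans_le (coheight_le_of_mem_closure hx)
  · intro x hx
    simp only [Set.mem_iUnion] at hx
    obtain ⟨D, hD, hx⟩ := hx
    exact hD.2.trans_le (coheight_le_of_mem_closure hx)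
  · intro x hx y hy h
    by_cases hxe : x ∈ excLocus f
    · exfalso
      obtain ⟨a, ha, rfl, rfl⟩ := h
      have haE : a ∈ E := ⟨ha, hxe⟩
      rw [hSE] at haE
      obtain ⟨D, hD, haD⟩ := haE
      rw [he D hD, ← specializes_iff_mem_closure] at haD
      rcases Corr.exc_coheight hf hc ⟨e D, (heE D hD).1, rfl, rfl⟩ (heE D hD).2 with h1 | h1
      · refine hx (Set.mem_biUnion (show D ∈ S₁ from ⟨hD, h1⟩) ?_)
        exact specializes_iff_mem_closure.mp (haD.map p.continuous)
      · refine hy (Set.mem_biUnion (show D ∈ S₂ from ⟨hD, h1⟩) ?_)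
        exact specializes_iff_mem_closure.mp (haD.map q.continuous)
    · rw [mem_excLocus] at hxe
      push Not at hxe
      obtain ⟨z, hz⟩ := hxe
      rwa [h.eq_right hz] at hz

theorem toRationalMap_ι_comp {V W : Scheme.{u}} [IrreducibleSpace V] (F : V.PartialMap W)
    [Nonempty F.domain] [IsDominant F.domain.ι] [PreirreducibleSpace F.domain] :
    F.domain.ι.toRationalMap.comp F.toRationalMap = F.hom.toRationalMap := by
  rw [toRationalMap_comp_of_factors F.domain.ι F (𝟙 _) (Category.id_comp _), Category.id_comp]

/-- On F⁻¹(dom G), which is dense, `G` after `F` is the inclusion: this holds for rational maps,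
hence for morphisms by reducedness and separatedness. -/
theorem pullback_partialMap (f : BirMap X Y) (F : X.scheme.PartialMap Y.scheme)
    (G : Y.scheme.PartialMap X.scheme) (hF : F.toRationalMap = f.hom)
    (hG : G.toRationalMap = f.inv) :
    Nonempty (pullback F.hom G.domain.ι : Scheme) ∧
      IsDominant (pullback.fst F.hom G.domain.ι) ∧
      pullback.fst F.hom G.domain.ι ≫ F.domain.ι = pullback.snd F.hom G.domain.ι ≫ G.hom := by
  have : Nonempty F.domain := F.dense_domain.nonempty.to_subtype
  have : Nonempty G.domain := G.dense_domain.nonempty.to_subtype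
  have : IsDominant F.domain.ι := Opens.isDominant_ι F.dense_domain
  have : IsDominant G.domain.ι := Opens.isDominant_ι G.dense_domain
  have : IsDominant F.hom := by
    rw [← PartialMap.isDominant_toRationalMap_iff, hF]; infer_instance
  have : Nonempty (pullback F.hom G.domain.ι : Scheme) := by
    obtain ⟨_, hy, x, rfl⟩ := F.hom.denseRange.inter_open_nonempty _ G.domain.2
      G.dense_domain.nonempty
    obtain ⟨w, -⟩ := Scheme.Pullback.exists_preimage_pullback (f := F.hom) (g := G.domain.ι) x
      ⟨_, hy⟩ rfl
    exact ⟨w⟩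
  let r := pullback.fst F.hom G.domain.ι
  let s := pullback.snd F.hom G.domain.ι
  have hrs : r ≫ F.hom = s ≫ G.domain.ι := pullback.condition
  have : IsDominant r := isDominant_of_isOpenImmersion r
  have : IsDominant (s ≫ G.domain.ι) := hrs ▸ inferInstance
  have : IsDominant s := IsDominant.of_comp_of_isOpenImmersion s G.domain.ι
  have : IsIntegral (pullback F.hom G.domain.ι) := isIntegral_of_isOpenImmersion r
  refine ⟨inferInstance, inferInstance, toRationalMap_injective ?_⟩
  change (r ≫ F.domain.ι).toRationalMap = (s ≫ G.hom).toRationalMap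
  have h1 := toRationalMap_ι_comp F
  have h2 := toRationalMap_ι_comp G
  simp only [hF] at h1
  simp only [hG] at h2
  rw [← toRationalMap_comp_toRationalMap s, ← h2, ← RationalMap.comp_assoc]
  simp only [toRationalMap_comp_toRationalMap, ← hrs]
  rw [← toRationalMap_comp_toRationalMap r F.domain.ι]
  simp only [← toRationalMap_comp_toRationalMap r F.hom, ← h1]
  rw [RationalMap.comp_assoc, RationalMap.comp_assoc, f.hom_inv_id, RationalMap.comp_id]

theorem exists_maximal_partialMap (f : BirMap X Y) : ∃ F : X.scheme.PartialMap Y.scheme,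
    F.toRationalMap = f.hom ∧ ∀ {W : Scheme.{u}} {a : W ⟶ X.scheme} {b : W ⟶ Y.scheme},
      f.IsRoof a b → Set.range a ⊆ F.domain := by
  refine ⟨f.hom.toPartialMap, RationalMap.toRationalMap_toPartialMap _, fun h => ?_⟩
  obtain ⟨p, hp, hs⟩ := h.exists_partialIso
  rw [← hs]
  have := p.toPartialMap.le_domain_toRationalMap
  rw [show p.toPartialMap.toRationalMap = f.hom from hp] at this
  exact this

/-- The maximal isomorphism between open subsets of `X` and `Y` that `f` induces. -/
theorem exists_maximal_roof (f : BirMap X Y) :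
    ∃ (W : Scheme.{u}) (a : W ⟶ X.scheme) (b : W ⟶ Y.scheme), f.IsRoof a b ∧
      ∀ x y, f.LocIso x y → ∃ w, a w = x ∧ b w = y := by
  obtain ⟨F, hF, hFm⟩ := exists_maximal_partialMap f
  obtain ⟨G, hG, hGm⟩ := exists_maximal_partialMap f.symm
  obtain ⟨h1, h2, h3⟩ := pullback_partialMap f F G hF hG
  obtain ⟨-, -, h6⟩ := pullback_partialMap f.symm G F hG hF
  have : IsDominant F.domain.ι := Opens.isDominant_ι F.dense_domain
  have : Nonempty F.domain := F.dense_domain.nonempty.to_subtype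
  let r := pullback.fst F.hom G.domain.ι
  let s := pullback.snd F.hom G.domain.ι
  have : IsIntegral (pullback F.hom G.domain.ι) := isIntegral_of_isOpenImmersion r
  -- Swapping the factors identifies F⁻¹(dom G) with G⁻¹(dom F). This makes `s`, a priori only a
  -- restriction of `F`, an open immersion.
  let i : pullback F.hom G.domain.ι ⟶ pullback G.hom F.domain.ι := pullback.lift s r h3.symm
  let i' : pullback G.hom F.domain.ι ⟶ pullback F.hom G.domain.ι :=
    pullback.lift (pullback.snd _ _) (pullback.fst _ _) h6.symm
  have hs : i ≫ pullback.fst _ _ = s := pullback.lift_fst _ _ _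
  have hr : i ≫ pullback.snd _ _ = r := pullback.lift_snd _ _ _
  have hi1 : i' ≫ r = pullback.snd _ _ := pullback.lift_fst _ _ _
  have hi2 : i' ≫ s = pullback.fst _ _ := pullback.lift_snd _ _ _
  have : IsIso i := by
    refine ⟨i', pullback.hom_ext ?_ ?_, pullback.hom_ext ?_ ?_⟩
    · change (i ≫ i') ≫ r = 𝟙 _ ≫ r
      rw [Category.assoc, hi1, hr, Category.id_comp]
    · change (i ≫ i') ≫ s = 𝟙 _ ≫ s
      rw [Category.assoc, hi2, hs, Category.id_comp]
    · rw [Category.assoc, hs, hi2, Category.id_comp]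
    · rw [Category.assoc, hr, hi1, Category.id_comp]
  have : IsOpenImmersion s := hs ▸ inferInstance
  refine ⟨pullback F.hom G.domain.ι, r ≫ F.domain.ι, s ≫ G.domain.ι,
    IsRoof.of_nonempty _ _ _ ?_, ?_⟩
  · rw [← hF, toRationalMap_comp_of_factors _ F r rfl]
    exact congrArg _ pullback.condition
  -- Since `F` and `G` are the largest representatives, any roof maps into both domains, hence into
  -- the fibre product.
  · rintro x y ⟨W, a, b, h, w, rfl, rfl⟩
    have hF' := hFm h
    have hG' := hGm h.symm
    obtain ⟨_, _, _, _, _, h⟩ := h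
    let t : W ⟶ F.domain := IsOpenImmersion.lift F.domain.ι a (by simpa using hF')
    let t' : W ⟶ G.domain := IsOpenImmersion.lift G.domain.ι b (by simpa using hG')
    have ht : t ≫ F.domain.ι = a := IsOpenImmersion.lift_fac _ _ _
    have ht' : t' ≫ G.domain.ι = b := IsOpenImmersion.lift_fac _ _ _
    have e : t ≫ F.hom = t' ≫ G.domain.ι := by
      rw [ht']
      apply toRationalMap_injective
      rw [← toRationalMap_comp_of_factors _ F t ht, hF, h]
    refine ⟨pullback.lift t t' e w, ?_, ?_⟩
    · rw [← Scheme.Hom.comp_apply, ← Category.assoc, pullback.lift_fst, ht]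
    · rw [← Scheme.Hom.comp_apply, ← Category.assoc, pullback.lift_snd, ht']

end CodimBir

end

/-! ### Gluing two models -/

noncomputable section

namespace CodimBir

open Scheme BirMap Limits

variable {k : Type u} [Field k] {X Y Z : Variety k}

/-- Two schemes over `S` can be glued along a common open subscheme. -/
theorem exists_glue {W X Y S : Scheme.{u}} (a : W ⟶ X) (b : W ⟶ Y) [IsOpenImmersion a]
    [IsOpenImmersion b] [IsReduced X] [IsReduced Y] (s : X ⟶ S) (t : Y ⟶ S)
    [LocallyOfFiniteType s] [LocallyOfFiniteType t] (h : a ≫ s = b ≫ t) :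
    ∃ (P : Scheme.{u}) (i : X ⟶ P) (j : Y ⟶ P) (p : P ⟶ S),
      IsReduced P ∧ LocallyOfFiniteType p ∧ IsOpenImmersion i ∧ IsOpenImmersion j ∧
      i ≫ p = s ∧ j ≫ p = t ∧ a ≫ i = b ≫ j ∧
      (∀ z : P, z ∈ Set.range i ∨ z ∈ Set.range j) ∧
      ∀ x y, i x = j y → ∃ w, a w = x ∧ b w = y := by
  have hF {i j : WalkingSpan} (f : i ⟶ j) : IsOpenImmersion ((span a b).map f) := by
    match i, j, f with
    | i, _, WidePushoutShape.Hom.id _ =>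
      change IsOpenImmersion ((span a b).map (𝟙 i))
      rw [CategoryTheory.Functor.map_id]; infer_instance
    | _, _, WidePushoutShape.Hom.init WalkingPair.left => assumption
    | _, _, WidePushoutShape.Hom.init WalkingPair.right => assumption
  have : ((span a b) ⋙ forget).IsLocallyDirected :=
    inferInstanceAs
      (((span a b : WidePushoutShape WalkingPair ⥤ Scheme) ⋙ forget).IsLocallyDirected)
  let i : X ⟶ pushout a b := pushout.inl a b
  let j : Y ⟶ pushout a b := pushout.inr a b
  have hs : i ≫ pushout.desc s t h = s := pushout.inl_desc _ _ _
  have ht : j ≫ pushout.desc s t h = t := pushout.inr_desc _ _ _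
  have hX (c : WalkingSpan) : IsReduced ((span a b).obj c) ∧
      LocallyOfFiniteType (colimit.ι (span a b) c ≫ pushout.desc s t h) := by
    match c with
    | WalkingSpan.zero =>
      have h1 : colimit.ι (span a b) WalkingSpan.zero = a ≫ i :=
        (colimit.w (span a b) WalkingSpan.Hom.fst).symm
      have h2 : colimit.ι (span a b) WalkingSpan.zero ≫ pushout.desc s t h = a ≫ s :=
        (congrArg (· ≫ pushout.desc s t h) h1).trans ((Category.assoc a i _).trans (by rw [hs]))
      rw [h2]
      have h3 : AlgebraicGeometry.IsReduced W := isReduced_of_isOpenImmersion a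
      exact ⟨h3, inferInstanceAs (LocallyOfFiniteType (a ≫ s))⟩
    | WalkingSpan.left => exact ⟨‹IsReduced X›, hs.symm ▸ ‹LocallyOfFiniteType s›⟩
    | WalkingSpan.right => exact ⟨‹IsReduced Y›, ht.symm ▸ ‹LocallyOfFiniteType t›⟩
  have hL : IsZariskiLocalAtSource @LocallyOfFiniteType :=
    HasRingHomProperty.instIsZariskiLocalAtSource (Q := RingHom.FiniteType)
  have hR (c : WalkingSpan) : IsReduced ((IsLocallyDirected.openCover (span a b)).X c) := (hX c).1
  refine ⟨pushout a b, i, j, pushout.desc s t h,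
    @IsReduced.of_openCover _ (IsLocallyDirected.openCover (span a b)) hR,
    IsZariskiLocalAtSource.of_openCover (P := @LocallyOfFiniteType)
      (IsLocallyDirected.openCover (span a b)) fun c => (hX c).2,
    inferInstanceAs (IsOpenImmersion (colimit.ι (span a b) WalkingSpan.left)),
    inferInstanceAs (IsOpenImmersion (colimit.ι (span a b) WalkingSpan.right)),
    hs, ht, pushout.condition, fun z => ?_, ?_⟩
  · obtain ⟨c, x, hx⟩ := IsLocallyDirected.ι_jointly_surjective (span a b) z
    match c, x, hx with
    | WalkingSpan.zero, x, hx =>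
      refine Or.inl ⟨a x, ?_⟩
      rw [← hx, ← colimit.w (span a b) WalkingSpan.Hom.fst]
      rfl
    | WalkingSpan.left, x, hx => exact Or.inl ⟨x, hx⟩
    | WalkingSpan.right, x, hx => exact Or.inr ⟨x, hx⟩
  · intro x y hxy
    obtain ⟨c, f, g, w, h1, h2⟩ := (IsLocallyDirected.ι_eq_ι_iff (span a b)
      (i := WalkingSpan.left) (j := WalkingSpan.right)).mp hxy
    match c, f, g, w, h1, h2 with
    | WalkingSpan.zero, WidePushoutShape.Hom.init _, WidePushoutShape.Hom.init _, w, h1, h2 =>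
      exact ⟨w, h1, h2⟩

theorem isDominant_spec_fractionRing (R K : Type u) [CommRing R] [IsDomain R] [Field K]
    [Algebra R K] [IsFractionRing R K] :
    IsDominant (Spec.map (CommRingCat.ofHom (algebraMap R K))) := by
  refine ⟨?_⟩
  refine (PrimeSpectrum.denseRange_comap_iff_ker_le_nilRadical (algebraMap R K)).mpr ?_
  rw [(RingHom.injective_iff_ker_eq_bot _).mp (IsFractionRing.injective R K)]
  exact bot_le

/-- Every point of the spectrum of a local ring specializes to the closed point, and open sets are
stable under generization. -/
theorem range_subset_range_of_closedPoint {R : Type u} [CommRing R] [IsLocalRing R]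
    {X Y : Scheme.{u}} (m : Spec (CommRingCat.of R) ⟶ Y) (i : X ⟶ Y) [IsOpenImmersion i]
    (h : m (IsLocalRing.closedPoint R) ∈ Set.range i) : Set.range m ⊆ Set.range i := by
  rintro _ ⟨x, rfl⟩
  exact ((IsLocalRing.specializes_closedPoint (R := R) x).map m.continuous).mem_open
    i.isOpenEmbedding.isOpen_range h

/-- Separatedness of a glued scheme, in terms of the closure of the graph. -/
theorem lift_unique_of_corr {g : BirMap X Y} (hsep : ∀ x y, Corr g x y → g.LocIso x y)
    {W P : Scheme.{u}} {a : W ⟶ X.scheme} {b : W ⟶ Y.scheme} (hg : g.IsRoof a b)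
    (hmax : ∀ x y, g.LocIso x y → ∃ w, a w = x ∧ b w = y)
    {i : X.scheme ⟶ P} {j : Y.scheme ⟶ P} [IsOpenImmersion i] [IsOpenImmersion j]
    (p : P ⟶ Spec (CommRingCat.of k)) (hi : i ≫ p = X.str) (hj : j ≫ p = Y.str)
    (hij : a ≫ i = b ≫ j) (hW : ∀ x y, i x = j y → ∃ w, a w = x ∧ b w = y)
    {R K : Type u} [CommRing R] [IsDomain R] [ValuationRing R] [Field K] [Algebra R K]
    [IsFractionRing R K] (l₁ l₂ : Spec (CommRingCat.of R) ⟶ P)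
    (hl : Spec.map (CommRingCat.ofHom (algebraMap R K)) ≫ l₁ =
      Spec.map (CommRingCat.ofHom (algebraMap R K)) ≫ l₂) (hp : l₁ ≫ p = l₂ ≫ p)
    (h₁ : l₁ (IsLocalRing.closedPoint R) ∈ Set.range i)
    (h₂ : l₂ (IsLocalRing.closedPoint R) ∈ Set.range j) :
    l₂ (IsLocalRing.closedPoint R) ∈ Set.range i := by
  have := hg.left
  let η : Spec (CommRingCat.of K) ⟶ Spec (CommRingCat.of R) :=
    Spec.map (CommRingCat.ofHom (algebraMap R K))
  have : IsDominant η := isDominant_spec_fractionRing R K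
  let c : Spec (CommRingCat.of R) := IsLocalRing.closedPoint R
  let m₁ := IsOpenImmersion.lift i l₁ (range_subset_range_of_closedPoint l₁ i h₁)
  let m₂ := IsOpenImmersion.lift j l₂ (range_subset_range_of_closedPoint l₂ j h₂)
  have hm₁ : m₁ ≫ i = l₁ := IsOpenImmersion.lift_fac _ _ _
  have hm₂ : m₂ ≫ j = l₂ := IsOpenImmersion.lift_fac _ _ _
  have hη : η ≫ m₁ ≫ i = η ≫ m₂ ≫ j := by rw [hm₁, hm₂]; exact hl
  let t : Spec (CommRingCat.of K) ⟶ W := IsOpenImmersion.lift a (η ≫ m₁) (by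
    rintro _ ⟨z, rfl⟩
    obtain ⟨w, hw, -⟩ := hW ((η ≫ m₁) z) ((η ≫ m₂) z) (by
      rw [← Scheme.Hom.comp_apply, ← Scheme.Hom.comp_apply, Category.assoc, Category.assoc, hη])
    exact ⟨w, hw⟩)
  have ht : t ≫ a = η ≫ m₁ := IsOpenImmersion.lift_fac _ _ _
  have ht' : t ≫ b = η ≫ m₂ := by
    rw [← cancel_mono j, Category.assoc, ← hij, reassoc_of% ht, hη, Category.assoc]
  let e : W ⟶ pullback X.str Y.str := pullback.lift a b hg.over
  let m : Spec (CommRingCat.of R) ⟶ pullback X.str Y.str := pullback.lift m₁ m₂ (by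
    rw [← hi, ← hj, reassoc_of% hm₁, reassoc_of% hm₂, hp])
  have he1 : e ≫ pullback.fst _ _ = a := pullback.lift_fst _ _ _
  have he2 : e ≫ pullback.snd _ _ = b := pullback.lift_snd _ _ _
  have hm1 : m ≫ pullback.fst _ _ = m₁ := pullback.lift_fst _ _ _
  have hm2 : m ≫ pullback.snd _ _ = m₂ := pullback.lift_snd _ _ _
  have hem : η ≫ m = t ≫ e := by
    apply pullback.hom_ext
    · rw [Category.assoc, Category.assoc, he1, hm1, ht]
    · rw [Category.assoc, Category.assoc, he2, hm2, ht']
  have hr : Set.range (η ≫ m) ⊆ graph g := by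
    rw [hem]
    rintro _ ⟨z, rfl⟩
    exact ⟨W, e, by rwa [he1, he2], t z, (Scheme.Hom.comp_apply _ _ _).symm⟩
  -- The generic point of the valuation ring lands in the graph, so the closed point lands in its
  -- closure. Then `hsep` and `hmax` place the pair of closed-point images on the gluing locus.
  have hc : m c ∈ closure (graph g) := by
    have h1 : m c ∈ closure (m '' Set.range η) :=
      image_closure_subset_closure_image m.continuous ⟨c, η.denseRange c, rfl⟩
    refine closure_mono ?_ h1
    rintro _ ⟨_, ⟨z, rfl⟩, rfl⟩
    exact hr ⟨z, Scheme.Hom.comp_apply _ _ _⟩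
  obtain ⟨w, -, hw⟩ := hmax (m₁ c) (m₂ c) (hsep _ _ ⟨m c, hc, by
    rw [← Scheme.Hom.comp_apply, hm1], by rw [← Scheme.Hom.comp_apply, hm2]⟩)
  refine ⟨a w, ?_⟩
  change _ = l₂ c
  rw [← hm₂, Scheme.Hom.comp_apply, ← hw, ← Scheme.Hom.comp_apply, hij, Scheme.Hom.comp_apply]

/-- Two varieties can be glued along the domain of a birational map with closed graph. -/
theorem exists_gluing {g : BirMap X Y} (hsep : ∀ x y, Corr g x y → g.LocIso x y) :
    ∃ (Z : Variety k) (i : X.scheme ⟶ Z.scheme) (j : Y.scheme ⟶ Z.scheme) (φ : BirMap X Z)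
      (ψ : BirMap Y Z), φ.IsRoof (𝟙 _) i ∧ ψ.IsRoof (𝟙 _) j ∧ φ = g.trans ψ ∧
      ∀ z : Z.scheme, z ∈ Set.range i ∨ z ∈ Set.range j := by
  obtain ⟨W, a, b, hg, hmax⟩ := exists_maximal_roof g
  have := hg.left
  have := hg.right
  have := hg.integral
  have := hg.dominant_left
  have := hg.dominant_right
  obtain ⟨P, i, j, p, _, _, _, _, hi, hj, hij, hP, hW⟩ := exists_glue a b X.str Y.str hg.over
  have : IsSeparated p := by
    have : IsLocallyNoetherian P := LocallyOfFiniteType.isLocallyNoetherian p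
    refine IsSeparated.of_valuativeCriterion p ?_
    rintro ⟨R, K, i₁, i₂, hS⟩
    refine ⟨fun ⟨l₁, h1, h1'⟩ ⟨l₂, h2, h2'⟩ => CommSq.LiftStruct.ext ?_⟩
    have hl := h1.trans h2.symm
    have hp := h1'.trans h2'.symm
    have hη := isDominant_spec_fractionRing R K
    -- Two lifts with closed points in one chart agree because the chart is separated. The mixed
    -- cases reduce to this through `lift_unique_of_corr`.
    have same {V : Variety k} (m : V.scheme ⟶ P) [IsOpenImmersion m]
        (h1 : l₁ (IsLocalRing.closedPoint R) ∈ Set.range m)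
        (h2 : l₂ (IsLocalRing.closedPoint R) ∈ Set.range m) : l₁ = l₂ := by
      rw [← IsOpenImmersion.lift_fac m l₁ (range_subset_range_of_closedPoint l₁ m h1),
        ← IsOpenImmersion.lift_fac m l₂ (range_subset_range_of_closedPoint l₂ m h2)]
      congr 1
      refine ext_of_isDominant (Spec.map (CommRingCat.ofHom (algebraMap R K))) ?_
      rw [← cancel_mono m, Category.assoc, Category.assoc, IsOpenImmersion.lift_fac,
        IsOpenImmersion.lift_fac, hl]
    rcases hP (l₁ (IsLocalRing.closedPoint R)) with h1 | h1 <;>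
      rcases hP (l₂ (IsLocalRing.closedPoint R)) with h2 | h2
    · exact same i h1 h2
    · exact same i h1 (lift_unique_of_corr hsep hg hmax p hi hj hij hW l₁ l₂ hl hp h1 h2)
    · exact same i (lift_unique_of_corr hsep hg hmax p hi hj hij hW l₂ l₁ hl.symm hp.symm h2 h1) h2
    · exact same j h1 h2
  have hdense : DenseRange (a ≫ i) := fun z => by
    have hcl {V : Scheme.{u}} (c : W ⟶ V) [IsDominant c] (m : V ⟶ P) (v : V)
        (hcm : c ≫ m = a ≫ i) : m v ∈ closure (Set.range (a ≫ i)) := by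
      refine closure_mono ?_ (image_closure_subset_closure_image m.continuous
        ⟨v, c.denseRange v, rfl⟩)
      rintro _ ⟨_, ⟨w, rfl⟩, rfl⟩
      exact ⟨w, by rw [← hcm, Scheme.Hom.comp_apply]⟩
    rcases hP z with ⟨x, rfl⟩ | ⟨y, rfl⟩
    · exact hcl a i x rfl
    · exact hcl b j y hij.symm
  have hirr : IsIrreducible (Set.univ : Set P) := by
    rw [← hdense.closure_range, ← Set.image_univ]
    exact ((irreducibleSpace_def W).mp inferInstance |>.image _
      (a ≫ i).continuous.continuousOn).closure
  have : IrreducibleSpace P := (irreducibleSpace_def P).mpr hirr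
  have : IsIntegral P := isIntegral_of_irreducibleSpace_of_isReduced P
  have : CompactSpace X.scheme := QuasiCompact.compactSpace_of_compactSpace X.str
  have : CompactSpace Y.scheme := QuasiCompact.compactSpace_of_compactSpace Y.str
  have : CompactSpace P := ⟨by
    rw [← Set.eq_univ_of_forall (s := Set.range i ∪ Set.range j) hP]
    exact (isCompact_range i.continuous).union (isCompact_range j.continuous)⟩
  have : QuasiCompact p := inferInstance
  let Z : Variety k := ⟨P, p, inferInstance, inferInstance, inferInstance, inferInstance⟩
  let i' : X.scheme ⟶ Z.scheme := i
  let j' : Y.scheme ⟶ Z.scheme := j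
  have : IsOpenImmersion i' := ‹IsOpenImmersion i›
  have : IsOpenImmersion j' := ‹IsOpenImmersion j›
  obtain ⟨φ, hφ⟩ := exists_isRoof_of_isOpenImmersion (Y := Z) i' hi
  obtain ⟨ψ, hψ⟩ := exists_isRoof_of_isOpenImmersion (Y := Z) j' hj
  refine ⟨Z, i', j', φ, ψ, hφ, hψ, inv_unique ?_, hP⟩
  apply toRationalMap_comp_left_cancel a
  have h1 := hφ.comp_hom_of_factors a a (Category.comp_id _)
  have h2 := hψ.comp_hom_of_factors b b (Category.comp_id _)
  have h3 : a ≫ i' = b ≫ j' := hij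
  rw [h1]
  simp only [h3, ← h2]
  change _ = a.toRationalMap.comp (g.hom.comp ψ.hom)
  rw [← RationalMap.comp_assoc]
  congr 1
  exact hg.comp_eq.symm

theorem coheight_genericPoint (X : Variety k) : Order.coheight (genericPoint X.scheme) = 0 :=
  Order.coheight_eq_zero.mpr
    (IsTop.isMax fun x => show x ≤ genericPoint X.scheme from genericPoint_specializes x)

theorem nonempty_compl_of_lt_coheight {n : ℕ∞} {C : Set X.scheme}
    (h : ∀ x ∈ C, n < Order.coheight x) : Cᶜ.Nonempty :=
  ⟨genericPoint X.scheme, fun hx => not_lt_zero ((h _ hx).trans_eq (coheight_genericPoint X))⟩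

/-- The product of the two inclusions is continuous and sends the graph of the restricted map into
the graph of `f`, hence closure into closure. This carries the separation condition to the open
subvarieties. -/
theorem Corr.map {X' Y' : Variety k} {ι : BirMap X' X} {κ : BirMap Y' Y} {i : X'.scheme ⟶ X.scheme}
    {j : Y'.scheme ⟶ Y.scheme} (hι : ι.IsRoof (𝟙 _) i) (hκ : κ.IsRoof (𝟙 _) j) {f : BirMap X Y}
    {x y} (h : Corr (ι.trans (f.trans κ.symm)) x y) : Corr f (i x) (j y) := by
  obtain ⟨e, he, rfl, rfl⟩ := h
  let μ : pullback X'.str Y'.str ⟶ pullback X.str Y.str :=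
    pullback.lift (pullback.fst _ _ ≫ i) (pullback.snd _ _ ≫ j) (by
      rw [Category.assoc, Category.assoc, ← hι.over, ← hκ.over, Category.id_comp,
        Category.id_comp, pullback.condition])
  have h1 : μ ≫ pullback.fst _ _ = pullback.fst _ _ ≫ i := pullback.lift_fst _ _ _
  have h2 : μ ≫ pullback.snd _ _ = pullback.snd _ _ ≫ j := pullback.lift_snd _ _ _
  refine ⟨μ e, ?_, by rw [← Scheme.Hom.comp_apply, h1, Scheme.Hom.comp_apply],
    by rw [← Scheme.Hom.comp_apply, h2, Scheme.Hom.comp_apply]⟩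
  refine closure_mono ?_ (image_closure_subset_closure_image μ.continuous ⟨e, he, rfl⟩)
  rintro _ ⟨_, ⟨W, m, hm, w, rfl⟩, rfl⟩
  refine ⟨W, m ≫ μ, ?_, w, Scheme.Hom.comp_apply _ _ _⟩
  have := hm.left
  have := hm.right
  have := hm.integral
  have h3 := (hι.symm.trans hm (m ≫ pullback.fst _ _) (𝟙 W) (by simp)).trans hκ (𝟙 W)
    (m ≫ pullback.snd _ _) (by simp)
  have h4 : (ι.symm.trans (ι.trans (f.trans κ.symm))).trans κ = f := by
    rw [← trans_assoc, symm_trans_self, refl_trans, trans_assoc, symm_trans_self, trans_refl]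
  rw [h4] at h3
  simpa only [Category.assoc, Category.id_comp, h1, h2] using h3

/-- Two varieties with compatible points of codimension `l + 1` glue to a single variety, up to
closed sets of codimension greater than `l + 1`. -/
theorem exists_gluing_of_compat {l : ℕ} {g : BirMap X Y} (hg : IsIsoInCodim l g)
    (hc : ∀ x y, Order.coheight x = (l + 1 : ℕ) → Order.coheight y = (l + 1 : ℕ) →
      Compat g x y) :
    ∃ (Z : Variety k) (φ : BirMap X Z) (ψ : BirMap Y Z), φ = g.trans ψ ∧
      (∀ x, Order.coheight x ≤ (l + 1 : ℕ) → ∃ z, φ.LocIso x z) ∧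
      (∀ y, Order.coheight y ≤ (l + 1 : ℕ) → ∃ z, ψ.LocIso y z) ∧
      ∀ z, (∃ x, φ.LocIso x z) ∨ ∃ y, ψ.LocIso y z := by
  obtain ⟨C, D, hC, hD, hC', hD', hsep⟩ := exists_shrinking hg hc
  obtain ⟨X', i, _, ι, hι, hi⟩ := exists_removal X C hC (nonempty_compl_of_lt_coheight hC')
  obtain ⟨Y', j, _, κ, hκ, hj⟩ := exists_removal Y D hD (nonempty_compl_of_lt_coheight hD')
  have hiC (x) : i x ∉ C := by
    have : i x ∈ Cᶜ := hi ▸ Set.mem_range_self x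
    exact this
  have hjD (y) : j y ∉ D := by
    have : j y ∈ Dᶜ := hj ▸ Set.mem_range_self y
    exact this
  have hloc (x) : ι.LocIso x (i x) := hι.locIso x
  have hloc' (y) : κ.LocIso y (j y) := hκ.locIso y
  -- With `C` and `D` removed, related points are locally isomorphic, which is the separatedness
  -- condition for gluing.
  obtain ⟨Z, m, n, φ, ψ, hφ, hψ, hφψ, hZ⟩ := exists_gluing (g := ι.trans (g.trans κ.symm))
    fun x y h => (hloc x).trans ((hsep _ (hiC x) _ (hjD y) (h.map hι hκ)).trans (hloc' y).symm)
  have hlocφ (x) : φ.LocIso x (m x) := hφ.locIso x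
  have hlocψ (y) : ψ.LocIso y (n y) := hψ.locIso y
  refine ⟨Z, ι.symm.trans φ, κ.symm.trans ψ, ?_, fun x hx => ?_, fun y hy => ?_, fun z => ?_⟩
  · rw [hφψ, trans_assoc, ← trans_assoc ι.symm, symm_trans_self, refl_trans, trans_assoc]
  · obtain ⟨x', rfl⟩ : x ∈ Set.range i := hi ▸ fun h => (hC' x h).not_ge hx
    exact ⟨_, (hloc x').symm.trans (hlocφ x')⟩
  · obtain ⟨y', rfl⟩ : y ∈ Set.range j := hj ▸ fun h => (hD' y h).not_ge hy
    exact ⟨_, (hloc' y').symm.trans (hlocψ y')⟩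
  · rcases hZ z with ⟨x, rfl⟩ | ⟨y, rfl⟩
    · exact Or.inl ⟨_, (hloc x).symm.trans (hlocφ x)⟩
    · exact Or.inr ⟨_, (hloc' y).symm.trans (hlocψ y)⟩

end CodimBir

end

/-! ### Commensurated sets under a single permutation -/

noncomputable section

namespace CodimBir

section Combinatorics

variable {S : Type*} (T : Equiv.Perm S) (A : Set S)

/-- For endpoints `a` and `b` there are two cases: a periodic orbit is finite, and on an aperiodic
one `b` is `T ^ d a` for at most one `d`, which bounds the steps from `a`. -/
theorem finite_between {F : Set S} (hF : F.Finite) :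
    {s | (∃ i : ℕ, ∃ a ∈ F, (T ^ i) a = s) ∧ ∃ j : ℕ, (T ^ j) s ∈ F}.Finite := by
  have h2 : ∀ a ∈ F, ∀ b ∈ F, {s | ∃ i j : ℕ, (T ^ i) a = s ∧ (T ^ j) s = b}.Finite := by
    intro a _ b _
    by_cases hp : ∃ p : ℕ, 0 < p ∧ (T ^ p) a = a
    · obtain ⟨p, hp0, hp⟩ := hp
      refine ((Set.finite_Iio p).image fun i => (T ^ i) a).subset ?_
      rintro s ⟨i, j, rfl, -⟩
      refine ⟨i % p, Nat.mod_lt _ hp0, ?_⟩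
      conv_rhs => rw [← Nat.mod_add_div i p, pow_add, pow_mul, Equiv.Perm.mul_apply]
      have hfix : ∀ m : ℕ, ((T ^ p) ^ m) a = a := fun m => by
        induction m with
        | zero => rfl
        | succ m ih => rw [pow_succ, Equiv.Perm.mul_apply, hp, ih]
      simp only [hfix]
    · push Not at hp
      by_cases hd : ∃ d : ℕ, (T ^ d) a = b
      · obtain ⟨d, hd⟩ := hd
        refine ((Set.finite_Iic d).image fun i => (T ^ i) a).subset ?_
        rintro s ⟨i, j, rfl, hj⟩
        refine ⟨i, ?_, rfl⟩
        by_contra hi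
        simp only [Set.mem_Iic, not_le] at hi
        rw [← hd, ← Equiv.Perm.mul_apply, ← pow_add] at hj
        have : j + i = d + (j + i - d) := by omega
        rw [this, pow_add, Equiv.Perm.mul_apply] at hj
        exact hp _ (by omega) ((T ^ d).injective hj)
      · refine Set.finite_empty.subset ?_
        rintro s ⟨i, j, rfl, hj⟩
        exact hd ⟨j + i, by rw [pow_add, Equiv.Perm.mul_apply, hj]⟩
  refine (hF.biUnion fun a ha => hF.biUnion fun b hb => h2 a ha b hb).subset ?_
  rintro s ⟨⟨i, a, ha, hi⟩, j, hj⟩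
  simp only [Set.mem_iUnion]
  exact ⟨a, ha, _, hj, i, j, hi, rfl⟩

/-- The states at which an orbit of `T` enters or leaves `A`. -/
def boundary : Set S :=
  {s | ¬ (s ∈ A ↔ T s ∈ A) ∨ ¬ (s ∈ A ↔ T⁻¹ s ∈ A)}

variable {T A}

theorem finite_boundary (h1 : (T '' A \ A).Finite) (h2 : (⇑T⁻¹ '' A \ A).Finite) :
    (boundary T A).Finite := by
  refine ((h1.union (h2.preimage (T⁻¹).injective.injOn)).union
    (h2.union (h1.preimage T.injective.injOn))).subset ?_
  rintro s (hs | hs)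
  · by_cases h : s ∈ A
    · exact Or.inr (Or.inr ⟨⟨s, h, rfl⟩, fun h' => hs ⟨fun _ => h', fun _ => h⟩⟩)
    · have h' : T s ∈ A := by_contra fun h' => hs ⟨fun h1 => absurd h1 h, fun h1 => absurd h1 h'⟩
      exact Or.inr (Or.inl ⟨⟨T s, h', by simp⟩, h⟩)
  · by_cases h : s ∈ A
    · exact Or.inl (Or.inr ⟨⟨s, h, rfl⟩, fun h' => hs ⟨fun _ => h', fun _ => h⟩⟩)
    · have h' : T⁻¹ s ∈ A :=
        by_contra fun h' => hs ⟨fun h1 => absurd h1 h, fun h1 => absurd h1 h'⟩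
      exact Or.inl (Or.inl ⟨⟨T⁻¹ s, h', by simp⟩, h⟩)

theorem exists_boundary_of_not_iff {s : S} {n : ℕ} (h : ¬ (s ∈ A ↔ (T ^ n) s ∈ A)) :
    ∃ i : ℕ, i ≤ n ∧ (T ^ i) s ∈ boundary T A := by
  induction n with
  | zero => simp at h
  | succ n ih =>
    by_cases h' : s ∈ A ↔ (T ^ n) s ∈ A
    · refine ⟨n, n.le_succ, Or.inl fun hc => h (h'.trans (hc.trans ?_))⟩
      rw [pow_succ', Equiv.Perm.mul_apply]
    · obtain ⟨i, hi, hb⟩ := ih h'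
      exact ⟨i, by omega, hb⟩

theorem boundary_inv : boundary T⁻¹ A = boundary T A := by
  ext s
  simp [boundary, or_comm]

/-- States from which a finite number of steps of `T`, and of `T⁻¹`, changes the membership
in `A`, are finite in number. -/
theorem finite_setOf_not_iff (hF : (boundary T A).Finite) :
    {s | (∃ n : ℕ, ¬ (s ∈ A ↔ (T ^ n) s ∈ A)) ∧
      ∃ n : ℕ, ¬ (s ∈ A ↔ (T⁻¹ ^ n) s ∈ A)}.Finite := by
  refine (finite_between T hF).subset ?_
  rintro s ⟨⟨n, hn⟩, m, hm⟩
  obtain ⟨i, -, hi⟩ := exists_boundary_of_not_iff hn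
  obtain ⟨j, -, hj⟩ := exists_boundary_of_not_iff hm
  rw [boundary_inv] at hj
  exact ⟨⟨j, _, hj, by rw [← Equiv.Perm.mul_apply, inv_pow, mul_inv_cancel, Equiv.Perm.one_apply]⟩,
    i, hi⟩

/-- States for which membership in `A` changes within `N` steps. -/
theorem finite_setOf_not_iff_le (hF : (boundary T A).Finite) (N : ℕ) :
    {s | ∃ n ≤ N, ¬ (s ∈ A ↔ (T ^ n) s ∈ A)}.Finite := by
  refine ((Set.finite_Iic N).biUnion fun i _ => hF.preimage ((T ^ i).injective.injOn)).subset ?_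
  rintro s ⟨n, hn, h⟩
  obtain ⟨i, hi, hb⟩ := exists_boundary_of_not_iff h
  simp only [Set.mem_iUnion]
  exact ⟨i, hi.trans hn, hb⟩

/-- No orbit of `T` leaves `A` and comes back, or enters `A` and leaves it again. -/
structure OrbitMonotone (T : Equiv.Perm S) (A : Set S) : Prop where
  convex : ∀ s, ∀ i j : ℕ, s ∈ A → (T ^ (i + j)) s ∈ A → (T ^ i) s ∈ A
  coconvex : ∀ s, ∀ i j : ℕ, (T ^ i) s ∈ A → s ∈ A ∨ (T ^ (i + j)) s ∈ A

theorem OrbitMonotone.inv (h : OrbitMonotone T A) : OrbitMonotone T⁻¹ A := by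
  have key (n m : ℕ) (s : S) : (T ^ n) ((T⁻¹ ^ (n + m)) s) = (T⁻¹ ^ m) s := by
    rw [pow_add, Equiv.Perm.mul_apply, inv_pow T n]
    exact (T ^ n).apply_symm_apply _
  have key' (n : ℕ) (s : S) : (T ^ n) ((T⁻¹ ^ n) s) = s := key n 0 s
  constructor
  · intro s i j h0 h1
    have := h.convex ((T⁻¹ ^ (i + j)) s) j i h1
    rw [add_comm i j, key', key] at this
    exact this h0
  · intro s i j h0
    have := h.coconvex ((T⁻¹ ^ (i + j)) s) j i
    rw [add_comm i j, key', key] at this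
    rw [add_comm i j]
    exact (this h0).symm

/-- T^{n+1}A \ A is the disjoint union of T^n(TA \ A) and T^n A \ A. Convexity keeps the first piece
outside `A`; coconvexity puts the second inside T^{n+1}A. Each step thus adds |TA \ A| elements, one
for each orbit that `A` meets in a backward half-line. -/
theorem OrbitMonotone.ncard_succ (h : OrbitMonotone T A) (hfin : (T '' A \ A).Finite) (n : ℕ) :
    (⇑(T ^ n) '' A \ A).Finite ∧ (⇑(T ^ n) '' A \ A).ncard = n * (T '' A \ A).ncard := by
  induction n with
  | zero => simp
  | succ n ih =>
    have key : ⇑(T ^ (n + 1)) '' A \ A =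
        (⇑(T ^ n) '' (T '' A \ A)) ∪ (⇑(T ^ n) '' A \ A) := by
      rw [Set.image_sdiff (T ^ n).injective, ← Set.image_comp, ← Equiv.Perm.coe_mul, ← pow_succ]
      ext s
      constructor
      · rintro ⟨h1, h2⟩
        by_cases h3 : s ∈ ⇑(T ^ n) '' A
        · exact Or.inr ⟨h3, h2⟩
        · exact Or.inl ⟨h1, h3⟩
      · rintro (⟨⟨r, hr, rfl⟩, h2⟩ | ⟨⟨r, hr, rfl⟩, h2⟩)
        · refine ⟨⟨r, hr, rfl⟩, fun h3 => h2 ⟨T r, ?_, ?_⟩⟩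
          · have := h.convex r 1 n hr (by rwa [add_comm])
            simpa using this
          · rw [← Equiv.Perm.mul_apply, ← pow_succ]
        · refine ⟨⟨T⁻¹ r, ?_, by rw [pow_succ, Equiv.Perm.mul_apply]; simp⟩, h2⟩
          have := h.coconvex (T⁻¹ r) 1 n (by simpa using hr)
          rw [add_comm, pow_succ, Equiv.Perm.mul_apply] at this
          simpa [h2] using this
    have hd : Disjoint (⇑(T ^ n) '' (T '' A \ A)) (⇑(T ^ n) '' A \ A) := by
      rw [Set.image_sdiff (T ^ n).injective]
      exact Set.disjoint_of_subset_right Set.sdiff_subset Set.disjoint_sdiff_left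
    have hf := hfin.image (T ^ n)
    refine ⟨key ▸ hf.union ih.1, ?_⟩
    rw [key, Set.ncard_union_eq hd hf ih.1, Set.ncard_image_of_injective _ (T ^ n).injective, ih.2]
    ring

/-- The error term does not depend on `T`, so it is uniform when the bound is applied to all powers
of one permutation. -/
theorem ncard_image_sdiff_le {A B : Set S} (hAB : (A \ B).Finite) (hBA : (B \ A).Finite)
    (hB : (T '' B \ B).Finite) :
    (T '' A \ A).ncard ≤ (T '' B \ B).ncard + ((A \ B).ncard + (B \ A).ncard) := by
  have hsub : T '' A \ A ⊆ (T '' B \ B) ∪ ((T '' (A \ B)) ∪ (B \ A)) := by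
    rintro _ ⟨⟨s, hs, rfl⟩, h2⟩
    by_cases h3 : s ∈ B
    · by_cases h4 : T s ∈ B
      · exact Or.inr (Or.inr ⟨h4, h2⟩)
      · exact Or.inl ⟨⟨s, h3, rfl⟩, h4⟩
    · exact Or.inr (Or.inl ⟨s, ⟨hs, h3⟩, rfl⟩)
  have hf := hAB.image T
  refine (Set.ncard_le_ncard hsub (hB.union (hf.union hBA))).trans ?_
  refine (Set.ncard_union_le _ _).trans (Nat.add_le_add_left ((Set.ncard_union_le _ _).trans ?_) _)
  rw [Set.ncard_image_of_injective _ T.injective]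

/-- A commensurated set can be made monotone along the orbits by discarding finitely many of its
elements and then taking the union with a translate. -/
theorem exists_orbitMonotone (h1 : (T '' A \ A).Finite) (h2 : (⇑T⁻¹ '' A \ A).Finite) :
    ∃ U ⊆ A, ∃ N : ℕ, (A \ U).Finite ∧ OrbitMonotone T (U ∪ ⇑(T ^ N) '' U) ∧
      ∀ s ∈ U, ∀ t ∈ ⇑(T ^ N) '' U, ∃ j : ℤ, (T ^ j) s ∈ A ∧ (T ^ j) t ∈ A := by
  have hF := finite_boundary h1 h2
  have hF' : (boundary T⁻¹ A).Finite := by rwa [boundary_inv]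
  have zadd (i j : ℤ) (s : S) : (T ^ i) ((T ^ j) s) = (T ^ (i + j)) s := by
    rw [zpow_add, Equiv.Perm.mul_apply]
  have znat (n : ℕ) (s : S) : (T ^ n) s = (T ^ (n : ℤ)) s := by rw [zpow_natCast]
  have zneg (n : ℕ) (s : S) : (T⁻¹ ^ n) s = (T ^ (-(n : ℤ))) s := by
    rw [zpow_neg, zpow_natCast, inv_pow]
  -- `P` and `M` collect the orbits that stay in `A` far forward and far backward. Orbits in both
  -- should be filled completely; by `hH` they miss `A` at finitely many states only.
  let P : Set S := {s | ∃ m : ℤ, ∀ n ≥ m, (T ^ n) s ∈ A}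
  let M : Set S := {s | ∃ m : ℤ, ∀ n ≤ m, (T ^ n) s ∈ A}
  have hP (s : S) (i : ℤ) (hs : s ∈ P) : (T ^ i) s ∈ P := by
    obtain ⟨m, hm⟩ := hs
    exact ⟨m - i, fun n hn => by rw [zadd]; exact hm _ (by omega)⟩
  have hM (s : S) (i : ℤ) (hs : s ∈ M) : (T ^ i) s ∈ M := by
    obtain ⟨m, hm⟩ := hs
    exact ⟨m - i, fun n hn => by rw [zadd]; exact hm _ (by omega)⟩
  have hH : ((P ∩ M) \ A).Finite := by
    refine (finite_setOf_not_iff hF).subset ?_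
    rintro s ⟨⟨⟨p, hp⟩, m, hm⟩, hs⟩
    refine ⟨⟨p.toNat, ?_⟩, (-m).toNat, ?_⟩
    · rw [znat]
      have := hp p.toNat (by omega)
      tauto
    · rw [zneg]
      have := hm (-(-m).toNat) (by omega)
      tauto
  -- A shift by one large `N` moves all these finitely many holes back into `A`, so the translate `T
  -- ^ N` of `U` fills them.
  obtain ⟨N, hN⟩ : ∃ N : ℕ, ∀ s ∈ (P ∩ M) \ A, (T ^ (-(N : ℤ))) s ∈ A := by
    have hm : ∀ s ∈ (P ∩ M) \ A, ∃ m : ℕ, ∀ n ≥ m, (T ^ (-(n : ℤ))) s ∈ A := by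
      rintro s ⟨⟨-, m, hm⟩, -⟩
      exact ⟨(-m).toNat, fun n hn => hm _ (by omega)⟩
    choose! m hm using hm
    obtain ⟨N, hN⟩ := (hH.image m).bddAbove
    exact ⟨N, fun s hs => hm s hs N (hN ⟨s, hs, rfl⟩)⟩
  -- Besides the orbits to be filled, only states on half-lines of `A` are kept. The margin `n ≤ N`
  -- on backward half-lines keeps their translate by `T ^ N` inside `A`.
  let U : Set S := {s | s ∈ A ∧ (s ∈ P ∩ M ∨ (∀ n : ℤ, n ≤ N → (T ^ n) s ∈ A) ∨
    ∀ n : ℤ, -N ≤ n → (T ^ n) s ∈ A)}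
  have himg (t : S) : t ∈ ⇑(T ^ N) '' U ↔ (T ^ (-(N : ℤ))) t ∈ U := by
    constructor
    · rintro ⟨s, hs, rfl⟩
      rw [znat, zadd]
      simpa using hs
    · intro ht
      exact ⟨_, ht, by rw [znat, zadd]; simp⟩
  have hB (s : S) : s ∈ U ∪ ⇑(T ^ N) '' U ↔
      s ∈ P ∩ M ∨ (∀ n : ℤ, n ≤ 0 → (T ^ n) s ∈ A) ∨ ∀ n : ℤ, -N ≤ n → (T ^ n) s ∈ A := by
    rw [Set.mem_union, himg]
    constructor
    · rintro (⟨-, h | h | h⟩ | ⟨-, h | h | h⟩)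
      · exact Or.inl h
      · exact Or.inr (Or.inl fun n hn => h n (by omega))
      · exact Or.inr (Or.inr h)
      · left
        have h3 := hP _ N h.1
        have h4 := hM _ N h.2
        rw [zadd] at h3 h4
        simpa using And.intro h3 h4
      · refine Or.inr (Or.inl fun n hn => ?_)
        have := h (n + N) (by omega)
        rwa [zadd, add_neg_cancel_right] at this
      · refine Or.inr (Or.inr fun n hn => ?_)
        have := h (n + N) (by omega)
        rwa [zadd, add_neg_cancel_right] at this
    · rintro (h | h | h)
      · by_cases hs : s ∈ A
        · exact Or.inl ⟨hs, Or.inl h⟩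
        · exact Or.inr ⟨hN s ⟨h, hs⟩, Or.inl ⟨hP _ _ h.1, hM _ _ h.2⟩⟩
      · refine Or.inr ⟨h _ (by omega), Or.inr (Or.inl fun n hn => ?_)⟩
        rw [zadd]
        exact h _ (by omega)
      · exact Or.inl ⟨by simpa using h 0 (by omega), Or.inr (Or.inr h)⟩
  refine ⟨U, fun s hs => hs.1, N, ?_, ⟨?_, ?_⟩, ?_⟩
  -- A discarded state leaves `A` at some time `n ≤ N` and at some time `m ≥ -N`. Either one exit
  -- occurs within `N` steps, or there are exits in both directions; each possibility allows
  -- finitely many states.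
  · refine ((finite_setOf_not_iff hF).union ((finite_setOf_not_iff_le hF N).union
      (finite_setOf_not_iff_le hF' N))).subset ?_
    rintro s ⟨hs, hU⟩
    have h3 : ¬ ∀ n : ℤ, n ≤ N → (T ^ n) s ∈ A := fun h => hU ⟨hs, Or.inr (Or.inl h)⟩
    have h4 : ¬ ∀ n : ℤ, -N ≤ n → (T ^ n) s ∈ A := fun h => hU ⟨hs, Or.inr (Or.inr h)⟩
    push Not at h3 h4
    obtain ⟨n, hn, h3⟩ := h3
    obtain ⟨m, hm, h4⟩ := h4
    by_cases hn0 : 0 ≤ n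
    · refine Or.inr (Or.inl ⟨n.toNat, by omega, fun h => h3 ?_⟩)
      rw [znat, Int.toNat_of_nonneg hn0] at h
      exact h.mp hs
    by_cases hm0 : m ≤ 0
    · refine Or.inr (Or.inr ⟨(-m).toNat, by omega, fun h => h4 ?_⟩)
      rw [zneg, Int.toNat_of_nonneg (by omega), neg_neg] at h
      exact h.mp hs
    · refine Or.inl ⟨⟨m.toNat, fun h => h4 ?_⟩, (-n).toNat, fun h => h3 ?_⟩
      · rw [znat, Int.toNat_of_nonneg (by omega)] at h
        exact h.mp hs
      · rw [zneg, Int.toNat_of_nonneg (by omega), neg_neg] at h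
        exact h.mp hs
  · intro s i j hs hij
    rw [hB, znat] at *
    push_cast at hij
    have hinv : s ∈ P ∩ M → (T ^ (i : ℤ)) s ∈ P ∩ M := fun h => ⟨hP _ _ h.1, hM _ _ h.2⟩
    rcases hs with hs | hs | hs
    · exact Or.inl (hinv hs)
    · have hsM : s ∈ M := ⟨0, hs⟩
      rcases hij with h | h | h
      · have h5 := hP _ (-(i + j : ℤ)) h.1
        rw [zadd, neg_add_cancel] at h5
        exact Or.inl (hinv ⟨by simpa using h5, hsM⟩)
      · refine Or.inr (Or.inl fun n hn => ?_)
        have := h (n - j) (by omega)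
        rw [zadd] at this ⊢
        rwa [show n - j + (i + j : ℤ) = n + i by ring] at this
      · refine Or.inl (hinv ⟨⟨i + j, fun n hn => ?_⟩, hsM⟩)
        have := h (n - (i + j)) (by omega)
        rwa [zadd, sub_add_cancel] at this
    · refine Or.inr (Or.inr fun n hn => ?_)
      rw [zadd]
      exact hs _ (by omega)
  · intro s i j hi
    rw [hB, hB]
    rw [hB, znat] at hi
    rw [znat]
    rcases hi with h | h | h
    · have h5 := hP _ (-i) h.1
      have h6 := hM _ (-i) h.2
      rw [zadd] at h5 h6
      exact Or.inl (Or.inl (by simpa using And.intro h5 h6))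
    · refine Or.inl (Or.inr (Or.inl fun n hn => ?_))
      have := h (n - i) (by omega)
      rwa [zadd, sub_add_cancel] at this
    · refine Or.inr (Or.inr (Or.inr fun n hn => ?_))
      have := h (n + j) (by omega)
      rw [zadd] at this ⊢
      push_cast
      rwa [show n + j + (i : ℤ) = n + (i + j) by ring] at this
  -- A common time in `A`: states on half-lines lie in `A` now, so `j = 0` serves two of them. A
  -- state of a filled orbit is in `A` at all sufficiently large times of either sign, so it can
  -- follow the half-line of the other state.
  · intro s hs t ht
    rw [himg] at ht
    have hs' : s ∈ P ∩ M ∨ (∀ n : ℤ, n ≤ 0 → (T ^ n) s ∈ A) ∨ ∀ n : ℤ, 0 ≤ n → (T ^ n) s ∈ A := by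
      rcases hs with ⟨-, h | h | h⟩
      · exact Or.inl h
      · exact Or.inr (Or.inl fun n hn => h n (by omega))
      · exact Or.inr (Or.inr fun n hn => h n (by omega))
    have ht' : t ∈ P ∩ M ∨ (∀ n : ℤ, n ≤ 0 → (T ^ n) t ∈ A) ∨ ∀ n : ℤ, 0 ≤ n → (T ^ n) t ∈ A := by
      rcases (hB t).mp (Or.inr ((himg t).mpr ht)) with h | h | h
      · exact Or.inl h
      · exact Or.inr (Or.inl h)
      · exact Or.inr (Or.inr fun n hn => h n (by omega))
    rcases hs' with ⟨⟨p, hp⟩, m, hm⟩ | hs | hs <;> rcases ht' with ⟨⟨q, hq⟩, r, hr⟩ | ht | ht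
    · exact ⟨max p q, hp _ (le_max_left _ _), hq _ (le_max_right _ _)⟩
    · exact ⟨min m 0, hm _ (min_le_left _ _), ht _ (min_le_right _ _)⟩
    · exact ⟨max p 0, hp _ (le_max_left _ _), ht _ (le_max_right _ _)⟩
    · exact ⟨min r 0, hs _ (min_le_right _ _), hr _ (min_le_left _ _)⟩
    · exact ⟨0, hs _ le_rfl, ht _ le_rfl⟩
    · exact ⟨0, hs _ le_rfl, ht _ le_rfl⟩
    · exact ⟨max q 0, hs _ (le_max_right _ _), hq _ (le_max_left _ _)⟩
    · exact ⟨0, hs _ le_rfl, ht _ le_rfl⟩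
    · exact ⟨0, hs _ le_rfl, ht _ le_rfl⟩

end Combinatorics

/-! ### Sequences at bounded distance from a linear one -/

section Growth

variable {e : ℕ → ℕ} {c C : ℕ}

theorem tendsto_div_of_near_linear (h1 : ∀ n, e n ≤ n * c + C) (h2 : ∀ n, n * c ≤ e n + C) :
    Tendsto (fun n : ℕ => (e n : ℝ) / n) atTop (𝓝 c) := by
  have h3 : Tendsto (fun n : ℕ => (C : ℝ) / n) atTop (𝓝 0) :=
    tendsto_const_div_atTop_nhds_zero_nat _
  have h4 : Tendsto (fun n : ℕ => (c : ℝ) - C / n) atTop (𝓝 c) := by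
    simpa using h3.const_sub (c : ℝ)
  have h5 : Tendsto (fun n : ℕ => (c : ℝ) + C / n) atTop (𝓝 c) := by
    simpa using h3.const_add (c : ℝ)
  refine tendsto_of_tendsto_of_tendsto_of_le_of_le' h4 h5 ?_ ?_
  all_goals
    filter_upwards [eventually_gt_atTop 0] with n hn
    have hn' : (0 : ℝ) < n := by exact_mod_cast hn
    have h6 : (e n : ℝ) ≤ n * c + C := by exact_mod_cast h1 n
    have h7 : (n : ℝ) * c ≤ e n + C := by exact_mod_cast h2 n
  · rw [le_div_iff₀ hn', sub_mul, div_mul_cancel₀ _ hn'.ne']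
    linarith
  · rw [div_le_iff₀ hn', add_mul, div_mul_cancel₀ _ hn'.ne']
    linarith

theorem bounded_or_isEquivalent (h1 : ∀ n, e n ≤ n * c + C) (h2 : ∀ n, n * c ≤ e n + C) :
    (∃ B : ℕ, ∀ n, e n ≤ B) ∨ ∃ c : ℝ, 0 < c ∧
      Asymptotics.IsEquivalent atTop (fun n : ℕ => (e n : ℝ)) (fun n : ℕ => c * n) := by
  rcases Nat.eq_zero_or_pos c with rfl | hc
  · exact Or.inl ⟨C, fun n => by simpa using h1 n⟩
  · have hc' : (0 : ℝ) < c := by exact_mod_cast hc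
    refine Or.inr ⟨c, hc', ?_⟩
    refine (Asymptotics.isEquivalent_iff_tendsto_one ?_).mpr ?_
    · filter_upwards [eventually_gt_atTop 0] with n hn
      positivity
    · have := (tendsto_div_of_near_linear h1 h2).div_const (c : ℝ)
      rw [div_self hc'.ne'] at this
      refine this.congr fun n => ?_
      simp only [Pi.div_apply]
      rw [div_div, mul_comm]

end Growth

end CodimBir

end

/-! ### Germs of models and the action of birational transformations -/

noncomputable section

namespace CodimBir

open BirMap

variable {k : Type u} [Field k] {X Y Z : Variety k}

/-- Points of birational models of `X` are identified when the models agree near them. -/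
instance germSetoid (X : Variety k) : Setoid (Σ Y : Variety k, BirMap Y X × Y.scheme) where
  r p q := (p.2.1.trans q.2.1.symm).LocIso p.2.2 q.2.2
  iseqv := by
    refine ⟨fun p => ?_, fun {p q} h => h.symm, fun {p q r} h h' => ?_⟩
    · rw [trans_symm_self]
      exact locIso_refl _
    · have := h.trans h'
      rwa [trans_assoc, ← trans_assoc q.2.1.symm, symm_trans_self, refl_trans] at this

/-- The germs of birational models of `X`. -/
def Germ (X : Variety k) : Type (u + 1) := Quotient (germSetoid X)

/-- The germ at `y` of the model `φ : Y ⇢ X`. -/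
def germ (φ : BirMap Y X) (y : Y.scheme) : Germ X := Quotient.mk (germSetoid X) ⟨Y, φ, y⟩

theorem germ_eq_iff {φ : BirMap Y X} {ψ : BirMap Z X} {y z} :
    germ φ y = germ ψ z ↔ (φ.trans ψ.symm).LocIso y z :=
  Quotient.eq (r := germSetoid X)

theorem germ_trans_eq_iff {α : BirMap Y Z} {ψ : BirMap Z X} {y z} :
    germ (α.trans ψ) y = germ ψ z ↔ α.LocIso y z := by
  rw [germ_eq_iff, trans_assoc, trans_symm_self, trans_refl]

theorem germ_injective (φ : BirMap Y X) : Function.Injective (germ φ) := fun y z h => by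
  rw [germ_eq_iff, trans_symm_self] at h
  exact h.eq_of_refl

/-- The action of a birational transformation on germs. -/
def germMap (f : Bir X) : Germ X → Germ X :=
  Quotient.lift (fun p => germ (p.2.1.trans f) p.2.2) fun p q h => by
    rw [germ_eq_iff, trans_symm_rev, trans_assoc, ← trans_assoc f, trans_symm_self, refl_trans]
    exact h

/-- `Bir(X)` acts on the germs of models of `X`. -/
instance : MulAction (Bir X) (Germ X) where
  smul f s := germMap f s
  one_smul s := by
    obtain ⟨⟨Y, φ, y⟩, rfl⟩ := Quotient.exists_rep s
    exact congrArg (germ · y) (trans_refl φ)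
  mul_smul f g s := by
    obtain ⟨⟨Y, φ, y⟩, rfl⟩ := Quotient.exists_rep s
    exact congrArg (germ · y) (trans_assoc φ g f).symm

/-- The permutation of the germs induced by a birational transformation. -/
abbrev germPerm (f : Bir X) : Equiv.Perm (Germ X) := MulAction.toPermHom (Bir X) (Germ X) f

theorem germPerm_germ (f : Bir X) (φ : BirMap Y X) (y) :
    germPerm f (germ φ y) = germ (φ.trans f) y := rfl

/-- The germs of a model at its points of codimension `m`. -/
def germsOfCodim (m : ℕ) (φ : BirMap Y X) : Set (Germ X) :=
  germ φ '' {y | Order.coheight y = m}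

theorem germPerm_image (m : ℕ) (f : Bir X) (φ : BirMap Y X) :
    germPerm f '' germsOfCodim m φ = germsOfCodim m (φ.trans f) := by
  rw [germsOfCodim, ← Set.image_comp]
  rfl

/-- The germ of `y` occurs on `Z` exactly when `α` is a local isomorphism at `y`, and local
isomorphisms preserve codimension. This turns exceptional points into a set difference. -/
theorem germsOfCodim_sdiff (m : ℕ) (α : BirMap Y Z) (ψ : BirMap Z X) :
    germsOfCodim m (α.trans ψ) \ germsOfCodim m ψ =
      germ (α.trans ψ) '' {y | y ∈ excLocus α ∧ Order.coheight y = m} := by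
  ext s
  constructor
  · rintro ⟨⟨y, hy, rfl⟩, h⟩
    refine ⟨y, ⟨mem_excLocus.mpr fun z hz => h ⟨z, ?_, (germ_trans_eq_iff.mpr hz).symm⟩, hy⟩, rfl⟩
    exact hz.coheight_eq.symm.trans hy
  · rintro ⟨y, ⟨h, hy⟩, rfl⟩
    refine ⟨⟨y, hy, rfl⟩, ?_⟩
    rintro ⟨z, -, hz⟩
    exact mem_excLocus.mp h z (germ_trans_eq_iff.mp hz.symm)

theorem finite_germsOfCodim_sdiff {l : ℕ} {α : BirMap Y Z} (h : IsIsoInCodim l α)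
    (ψ : BirMap Z X) :
    (germsOfCodim (l + 1) (α.trans ψ) \ germsOfCodim (l + 1) ψ).Finite := by
  rw [germsOfCodim_sdiff]
  exact (finite_excLocus_coheight h).image _

theorem ncard_germsOfCodim_sdiff {l : ℕ} {α : BirMap Y Z} (h : IsIsoInCodim l α)
    (ψ : BirMap Z X) :
    (germsOfCodim (l + 1) (α.trans ψ) \ germsOfCodim (l + 1) ψ).ncard = (Exc (l + 1) α).ncard := by
  rw [germsOfCodim_sdiff, ncard_Exc h, Set.ncard_image_of_injective _ (germ_injective _)]

theorem conj_trans (φ : BirMap Y X) (f : Bir X) : (conj φ f).trans φ = φ.trans f := by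
  rw [conj, trans_assoc, symm_trans_self, trans_refl]

theorem conj_inv (φ : BirMap Y X) (f : Bir X) : conj φ f⁻¹ = (conj φ f).symm :=
  trans_assoc φ f.symm φ.symm

theorem IsIsoInCodim.conj {l : ℕ} {φ : BirMap Y X} {f : Bir X} (hφ : IsIsoInCodim l φ)
    (hf : f ∈ Psaut l X) : IsIsoInCodim l (conj φ f) :=
  (hφ.trans hf).trans hφ.symm

theorem inv_mem_Psaut {l : ℕ} {f : Bir X} (hf : f ∈ Psaut l X) : f⁻¹ ∈ Psaut l X :=
  IsIsoInCodim.symm hf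

theorem pow_mem_Psaut {l : ℕ} {f : Bir X} (hf : f ∈ Psaut l X) (n : ℕ) : f ^ n ∈ Psaut l X := by
  induction n with
  | zero =>
    rw [pow_zero]
    exact isIsoInCodim_refl l X
  | succ n ih =>
    rw [pow_succ']
    exact IsIsoInCodim.trans ih hf

theorem ncard_Exc_conj {l : ℕ} {φ : BirMap Y X} {f : Bir X} (hφ : IsIsoInCodim l φ)
    (hf : f ∈ Psaut l X) :
    (germPerm f '' germsOfCodim (l + 1) φ \ germsOfCodim (l + 1) φ).Finite ∧
      (germPerm f '' germsOfCodim (l + 1) φ \ germsOfCodim (l + 1) φ).ncard =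
        (Exc (l + 1) (conj φ f)).ncard := by
  rw [germPerm_image, ← conj_trans]
  exact ⟨finite_germsOfCodim_sdiff (hφ.conj hf) φ, ncard_germsOfCodim_sdiff (hφ.conj hf) φ⟩

theorem ncard_Exc_eq {l : ℕ} {f : Bir X} (hf : f ∈ Psaut l X) :
    (germPerm f '' germsOfCodim (l + 1) (refl X) \ germsOfCodim (l + 1) (refl X)).Finite ∧
      (germPerm f '' germsOfCodim (l + 1) (refl X) \ germsOfCodim (l + 1) (refl X)).ncard =
        (Exc (l + 1) f).ncard := by
  have h : conj (refl X) f = f := by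
    rw [conj, refl_trans]
    exact trans_refl f
  have := ncard_Exc_conj (isIsoInCodim_refl l X) hf
  rwa [h] at this

/-- If the exceptional components of the powers grow exactly linearly on one model, they grow
linearly up to a bounded error on any other. -/
theorem exists_near_linear {l : ℕ} {φ : BirMap Y X} {f : Bir X} (hφ : IsIsoInCodim l φ)
    (hf : f ∈ Psaut l X) {c : ℕ}
    (h : ∀ n, (⇑(germPerm f ^ n) '' germsOfCodim (l + 1) φ \ germsOfCodim (l + 1) φ).ncard =
      n * c) :
    ∃ C : ℕ, (∀ n, (Exc (l + 1) (f ^ n)).ncard ≤ n * c + C) ∧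
      ∀ n, n * c ≤ (Exc (l + 1) (f ^ n)).ncard + C := by
  have hBA := finite_germsOfCodim_sdiff hφ (refl X)
  have hAB := finite_germsOfCodim_sdiff hφ.symm φ
  rw [trans_refl] at hBA
  rw [symm_trans_self] at hAB
  have h1 (n : ℕ) := ncard_Exc_eq (pow_mem_Psaut hf n)
  have h2 (n : ℕ) := ncard_Exc_conj hφ (pow_mem_Psaut hf n)
  have hp (n : ℕ) : germPerm (f ^ n) = germPerm f ^ n := map_pow _ _ _
  refine ⟨(germsOfCodim (l + 1) (refl X) \ germsOfCodim (l + 1) φ).ncard +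
    (germsOfCodim (l + 1) φ \ germsOfCodim (l + 1) (refl X)).ncard, fun n => ?_, fun n => ?_⟩
  · rw [← (h1 n).2, ← h n, ← hp]
    exact ncard_image_sdiff_le hAB hBA (h2 n).1
  · rw [← (h1 n).2, ← h n, ← hp, add_comm (Set.ncard (germsOfCodim (l + 1) (refl X) \ _))]
    exact ncard_image_sdiff_le hBA hAB (h1 n).1

theorem dynNumber_eq {m : ℕ} {f : Bir X} {c C : ℕ}
    (h1 : ∀ n, (Exc m (f ^ n)).ncard ≤ n * c + C) (h2 : ∀ n, n * c ≤ (Exc m (f ^ n)).ncard + C) :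
    dynNumber m f = c :=
  (tendsto_div_of_near_linear h1 h2).limUnder_eq

/-- Removing finitely many points of codimension `l + 1`. -/
theorem exists_germsOfCodim_eq {l : ℕ} {U : Set (Germ X)}
    (hU : U ⊆ germsOfCodim (l + 1) (refl X)) (hfin : (germsOfCodim (l + 1) (refl X) \ U).Finite) :
    ∃ (X₀ : Variety k) (ι : BirMap X₀ X), IsIsoInCodim l ι ∧ germsOfCodim (l + 1) ι = U := by
  let S : Set X.scheme := {x | Order.coheight x = (l + 1 : ℕ) ∧ germ (refl X) x ∉ U}
  have hS : S.Finite := by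
    refine Set.Finite.of_finite_image (hfin.subset ?_) (germ_injective (refl X)).injOn
    rintro _ ⟨x, hx, rfl⟩
    exact ⟨⟨x, hx.1, rfl⟩, hx.2⟩
  let C : Set X.scheme := ⋃ x ∈ S, closure {x}
  have hC : IsClosed C := hS.isClosed_biUnion fun _ _ => isClosed_closure
  have hCl : ∀ x ∈ C, ((l + 1 : ℕ) : ℕ∞) ≤ Order.coheight x := fun x hx => by
    simp only [C, Set.mem_iUnion] at hx
    obtain ⟨y, hy, hx⟩ := hx
    exact hy.1.ge.trans (coheight_le_of_mem_closure hx)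
  -- A proper specialization of a point of codimension `l + 1` has larger codimension, so removing
  -- the closures removes no other point of that codimension.
  have hCS : ∀ x ∈ C, Order.coheight x = (l + 1 : ℕ) → x ∈ S := fun x hx hxl => by
    simp only [C, Set.mem_iUnion] at hx
    obtain ⟨y, hy, hx⟩ := hx
    have hle : x ≤ y := specializes_iff_mem_closure.mpr hx
    by_cases hge : y ≤ x
    · rwa [show x = y from ((show y ⤳ x from hle).antisymm hge).eq.symm]
    · have hlt : x < y := ⟨hle, hge⟩
      have := Order.coheight_strictAnti hlt (by rw [hy.1]; exact ENat.natCast_lt_top _)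
      rw [hy.1, hxl] at this
      exact absurd this (lt_irrefl _)
  have hlt : (l : ℕ∞) < (l + 1 : ℕ) := by exact_mod_cast l.lt_succ_self
  obtain ⟨X₀, j, _, ι, hι, hj⟩ := exists_removal X C hC
    (nonempty_compl_of_lt_coheight fun x hx => hlt.trans_le (hCl x hx))
  have hloc (y) : ι.LocIso y (j y) := hι.locIso y
  have hjC (y) : j y ∉ C := by
    have : j y ∈ Cᶜ := hj ▸ Set.mem_range_self y
    exact this
  have hg (y) : germ ι y = germ (refl X) (j y) := by
    rw [← trans_refl ι]
    exact germ_trans_eq_iff.mpr (hloc y)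
  refine ⟨X₀, ι, isIsoInCodim_iff.mpr ⟨fun y _ => ⟨_, hloc y⟩, fun x hx => ?_⟩, ?_⟩
  · obtain ⟨y, rfl⟩ : x ∈ Set.range j := hj ▸ fun h => (hlt.trans_le (hCl x h)).not_ge hx
    exact ⟨y, hloc y⟩
  · ext s
    constructor
    · rintro ⟨y, hy, rfl⟩
      by_contra hn
      rw [hg] at hn
      refine hjC y (Set.mem_biUnion (show j y ∈ S from ⟨?_, hn⟩) (subset_closure rfl))
      exact (hloc y).coheight_eq.symm.trans hy
    · intro hs
      obtain ⟨x, hx, rfl⟩ := hU hs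
      obtain ⟨y, rfl⟩ : x ∈ Set.range j := hj ▸ fun h => (hCS x h hx).2 hs
      exact ⟨y, (hloc y).coheight_eq.trans hx, hg y⟩

/-- Gluing models realizes the union of their germs of codimension `l + 1`. -/
theorem exists_germsOfCodim_eq_union {l : ℕ} {φ : BirMap Y X} {ψ : BirMap Z X}
    (hφ : IsIsoInCodim l φ) (hψ : IsIsoInCodim l ψ)
    (h : ∀ s ∈ germsOfCodim (l + 1) φ, ∀ t ∈ germsOfCodim (l + 1) ψ, ∃ f : Bir X,
      germPerm f s ∈ germsOfCodim (l + 1) (refl X) ∧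
        germPerm f t ∈ germsOfCodim (l + 1) (refl X)) :
    ∃ (V : Variety k) (θ : BirMap V X), IsIsoInCodim l θ ∧
      germsOfCodim (l + 1) θ = germsOfCodim (l + 1) φ ∪ germsOfCodim (l + 1) ψ := by
  have hg : IsIsoInCodim l (φ.trans ψ.symm) := hφ.trans hψ.symm
  obtain ⟨V, α, β, hαβ, hα, hβ, hV⟩ := exists_gluing_of_compat hg fun y z hy hz => by
    obtain ⟨f, ⟨x, -, hx⟩, x', -, hx'⟩ := h _ ⟨y, hy, rfl⟩ _ ⟨z, hz, rfl⟩
    rw [germPerm_germ, ← trans_refl (φ.trans f), eq_comm, germ_trans_eq_iff] at hx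
    rw [germPerm_germ, ← trans_refl (ψ.trans f), eq_comm, germ_trans_eq_iff] at hx'
    -- The common variety is `X` itself, reached by moving both markings by the same `f`.
    refine ⟨X, φ.trans f, ψ.trans f, ?_, ⟨x, hx⟩, x', hx'⟩
    rw [trans_assoc, ← trans_assoc ψ.symm, symm_trans_self, refl_trans]
  have e1 : α.trans (α.symm.trans φ) = φ := by rw [← trans_assoc, trans_symm_self, refl_trans]
  have e2 : β.trans (α.symm.trans φ) = ψ := by
    rw [hαβ]
    simp only [trans_symm_rev, symm_symm, trans_assoc, symm_trans_self, trans_refl]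
    rw [← trans_assoc, trans_symm_self, refl_trans]
  have g1 {y v} (hv : α.LocIso y v) : germ (α.symm.trans φ) v = germ φ y := by
    rw [← germ_trans_eq_iff.mpr hv, e1]
  have g2 {z v} (hv : β.LocIso z v) : germ (α.symm.trans φ) v = germ ψ z := by
    rw [← germ_trans_eq_iff.mpr hv, e2]
  have hl : (l : ℕ∞) ≤ (l + 1 : ℕ) := by exact_mod_cast l.le_succ
  refine ⟨V, α.symm.trans φ, IsIsoInCodim.trans (isIsoInCodim_iff.mpr ⟨fun v hv => ?_,
    fun y hy => ?_⟩) hφ, ?_⟩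
  · rcases hV v with ⟨y, hy⟩ | ⟨z, hz⟩
    · exact ⟨y, hy.symm⟩
    · obtain ⟨y, hy⟩ := (isIsoInCodim_iff.mp hg).2 z (hz.coheight_eq.trans_le hv)
      exact ⟨y, (hαβ ▸ hy.trans hz : α.LocIso y v).symm⟩
  · obtain ⟨v, hv⟩ := hα y (hy.trans hl)
    exact ⟨v, hv.symm⟩
  · ext s
    constructor
    · rintro ⟨v, hv, rfl⟩
      rcases hV v with ⟨y, hy⟩ | ⟨z, hz⟩
      · exact Or.inl ⟨y, hy.coheight_eq.trans hv, (g1 hy).symm⟩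
      · exact Or.inr ⟨z, hz.coheight_eq.trans hv, (g2 hz).symm⟩
    · rintro (⟨y, hy, rfl⟩ | ⟨z, hz, rfl⟩)
      · obtain ⟨v, hv⟩ := hα y hy.le
        exact ⟨v, hv.coheight_eq.symm.trans hy, g1 hv⟩
      · obtain ⟨v, hv⟩ := hβ z hz.le
        exact ⟨v, hv.coheight_eq.symm.trans hz, g2 hv⟩

/-- Some model of `X` has a set of germs of codimension `l + 1` that every orbit of `f` meets in
a monotone way. -/
theorem exists_orbitMonotone_model {l : ℕ} {f : Bir X} (hf : f ∈ Psaut l X) :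
    ∃ (Y : Variety k) (φ : BirMap Y X), IsIsoInCodim l φ ∧
      OrbitMonotone (germPerm f) (germsOfCodim (l + 1) φ) := by
  have hi : germPerm f⁻¹ = (germPerm f)⁻¹ := map_inv _ _
  have h2 := (ncard_Exc_eq (inv_mem_Psaut hf)).1
  rw [hi] at h2
  obtain ⟨U, hU, N, hfin, hmono, hcompat⟩ := exists_orbitMonotone (ncard_Exc_eq hf).1 h2
  obtain ⟨X₀, ι, hι, hιU⟩ := exists_germsOfCodim_eq hU hfin
  -- The translate of `U` is realized by the same variety `X₀`, with its marking followed by `f ^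
  -- N`.
  have hN : germsOfCodim (l + 1) (ι.trans (f ^ N)) = ⇑(germPerm f ^ N) '' U := by
    have hp : germPerm (f ^ N) = germPerm f ^ N := map_pow _ _ _
    rw [← germPerm_image, hιU, hp]
  obtain ⟨Y, φ, hφ, hφU⟩ := exists_germsOfCodim_eq_union hι (hι.trans (pow_mem_Psaut hf N)) (by
    rw [hN, hιU]
    intro s hs t ht
    obtain ⟨j, h1, h2⟩ := hcompat s hs t ht
    have hp : germPerm (f ^ j) = germPerm f ^ j := map_zpow _ _ _
    exact ⟨f ^ j, hp ▸ ⟨h1, h2⟩⟩)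
  refine ⟨Y, φ, hφ, ?_⟩
  rwa [hφU, hN, hιU]

theorem lt_codim_excLocus_iff {l : ℕ} {f : BirMap X Y} (hf : IsIsoInCodim l f) :
    ((l + 1 : ℕ) : ℕ∞) < codim (excLocus f) ↔ (Exc (l + 1) f).ncard = 0 := by
  rw [lt_codim_iff f.isClosed_excLocus, ncard_Exc hf,
    Set.ncard_eq_zero (finite_excLocus_coheight hf), Set.eq_empty_iff_forall_notMem]
  have h := (lt_codim_iff f.isClosed_excLocus l).mp hf.1
  constructor
  · rintro h' x ⟨hx, hxl⟩
    exact (h' x hx).ne' hxl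
  · intro h' x hx
    refine lt_of_le_of_ne ?_ fun he => h' x ⟨hx, he.symm⟩
    push_cast
    exact (ENat.add_one_le_iff (ENat.natCast_ne_top l)).mpr (h x hx)

/-- With no exceptional component of codimension `l + 1` on `Y`, the germ set of `Y` is mapped into
itself by `f`, hence by all its powers; the comparison with `X` then has slope 0. Monotonicity along
orbits is not needed here. -/
theorem dynNumber_eq_zero_of_conj {l : ℕ} {φ : BirMap Y X} {f : Bir X} (hφ : IsIsoInCodim l φ)
    (hf : f ∈ Psaut l X) (h : (Exc (l + 1) (conj φ f)).ncard = 0) : dynNumber (l + 1) f = 0 := by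
  obtain ⟨hfin, hcard⟩ := ncard_Exc_conj hφ hf
  rw [h, Set.ncard_eq_zero hfin, Set.sdiff_eq_empty] at hcard
  have hpow (n : ℕ) : ⇑(germPerm f ^ n) '' germsOfCodim (l + 1) φ ⊆ germsOfCodim (l + 1) φ := by
    induction n with
    | zero => simp
    | succ n ih =>
      rw [pow_succ', Equiv.Perm.coe_mul, Set.image_comp]
      exact (Set.image_mono ih).trans hcard
  obtain ⟨C, h1, h2⟩ := exists_near_linear hφ hf (c := 0) fun n => by
    rw [Set.sdiff_eq_empty.mpr (hpow n), Set.ncard_empty, mul_zero]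
  exact (dynNumber_eq h1 h2).trans Nat.cast_zero

end CodimBir

end

theorem mainTheorem11 (k : Type u) [Field k] (X : Variety k) (l : ℕ) (f : Bir X)
    (hf : f ∈ Psaut l X) :
    -- (1) the limit that defines the dynamical number exists, and it is an integer
    (Tendsto (fun n : ℕ => ((Exc (l + 1) (f ^ n)).ncard : ℝ) / n) atTop
        (𝓝 (dynNumber (l + 1) f)) ∧
      ∃ N : ℤ, dynNumber (l + 1) f = N) ∧
    -- (2) the sequence is bounded or grows asymptotically linearly
    ((∃ C : ℕ, ∀ n : ℕ, (Exc (l + 1) (f ^ n)).ncard ≤ C) ∨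
      ∃ c : ℝ, 0 < c ∧
        Asymptotics.IsEquivalent atTop (fun n : ℕ => ((Exc (l + 1) (f ^ n)).ncard : ℝ))
          (fun n : ℕ => c * n)) ∧
    -- (3) some conjugate realizes both dynamical numbers
    (∃ (Y : Variety k) (φ : BirMap Y X), IsIsoInCodim l φ ∧
      ((Exc (l + 1) (conj φ f)).ncard : ℝ) = dynNumber (l + 1) f ∧
      ((Exc (l + 1) (conj φ f⁻¹)).ncard : ℝ) = dynNumber (l + 1) f⁻¹) ∧
    -- (4) both vanish iff some conjugate is an automorphism in codimension `l + 1`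
    ((dynNumber (l + 1) f = 0 ∧ dynNumber (l + 1) f⁻¹ = 0) ↔
      ∃ (Y : Variety k) (φ : BirMap Y X), IsIsoInCodim l φ ∧ conj φ f ∈ Psaut (l + 1) Y) := by
  have hf' := inv_mem_Psaut hf
  obtain ⟨Y, φ, hφ, hmono⟩ := exists_orbitMonotone_model hf
  -- The same model serves `f` and `f⁻¹`, because monotonicity along orbits is symmetric under
  -- inversion. The slope is the number of exceptional components of the conjugate of `g`.
  have key {g : Bir X} (hg : g ∈ Psaut l X)
      (hm : OrbitMonotone (germPerm g) (germsOfCodim (l + 1) φ)) :=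
    exists_near_linear hφ hg fun n => by
      rw [((hm.ncard_succ (ncard_Exc_conj hφ hg).1) n).2, (ncard_Exc_conj hφ hg).2]
  obtain ⟨C, h1, h2⟩ := key hf hmono
  obtain ⟨C', h1', h2'⟩ := key hf' (by
    have hi : germPerm f⁻¹ = (germPerm f)⁻¹ := map_inv _ _
    exact hi ▸ hmono.inv)
  have hν := dynNumber_eq h1 h2
  have hν' := dynNumber_eq h1' h2'
  refine ⟨⟨hν ▸ tendsto_div_of_near_linear h1 h2, _, hν.trans (Int.cast_natCast _).symm⟩,
    bounded_or_isEquivalent h1 h2, ⟨Y, φ, hφ, hν.symm, hν'.symm⟩, ?_, ?_⟩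
  · rintro ⟨h0, h0'⟩
    rw [hν, Nat.cast_eq_zero] at h0
    rw [hν', Nat.cast_eq_zero] at h0'
    exact ⟨Y, φ, hφ, (lt_codim_excLocus_iff (hφ.conj hf)).mpr h0,
      conj_inv φ f ▸ (lt_codim_excLocus_iff (hφ.conj hf')).mpr h0'⟩
  · rintro ⟨Z, ψ, hψ, h⟩
    exact ⟨dynNumber_eq_zero_of_conj hψ hf ((lt_codim_excLocus_iff (hψ.conj hf)).mp h.1),
      dynNumber_eq_zero_of_conj hψ hf'
        ((lt_codim_excLocus_iff (hψ.conj hf')).mp (conj_inv ψ f ▸ h.2))⟩
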